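/- **Proposition 3.4.** For $n\in\mathbb N$ let $U_n$ be the group of unitary matrices in $M_n(\mathbb C)$ and let $p\ge 2$ be an even integer. For $x\in M_n(\mathbb C)$ put $\|x\|_p=\operatorname{Tr}\big((x^*x)^{p/2}\big)^{1/p}$. For a piecewise smooth curve $\gamma:[0,1]\to U_n$ let $L_p(\gamma)=\int_0^1\|\dot\gamma(t)\|_p\,dt$, and let $d_p(u,v)$ be the infimum of $L_p(\gamma)$ over all piecewise smooth curves $\gamma$ in $U_n$ from $u$ to $v$. A *geodesic* joining $u$ and $v$ is a piecewise smooth curve $\gamma$ in $U_n$ from $u$ to $v$ of minimal length, i.e. $L_p(\gamma)=d_p(u,v)$. A set $M\subseteq U_n$ is *geodesically convex* (with respect to $d_p$) if for all $u,v\in M$ there is a geodesic joining $u$ and $v$ that is contained in $M$. Write $B_p(u,r)=\{v\in U_n: d_p(u,v)<r\}$ and $B_p[u,r]=\{v\in U_n: d_p(u,v)\le r\}$. 1. For every $n$, every $u\in U_n$ and every real $r\le\pi/2$, the open ball $B_p(u,r)$ is geodesically convex. 2. For every $n$, every $u\in U_n$ and every real $r<\pi/2$, the closed ball $B_p[u,r]$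 is geodesically convex. 3. The bound $\pi/2$ is optimal, already in $U_1$: for every $u\in U_1$, the open ball $B_p(u,r)$ is not geodesically convex when $\pi/2<r\le\pi$, and the closed ball $B_p[u,r]$ is not geodesically convex when $\pi/2<r<\pi$. -/

import Mathlib

open scoped Matrix ContDiff Matrix.Norms.L2Operator

noncomputable section

namespace FinslerUnitary

/-- The group `U_n` of `n × n` complex unitary matrices. -/
abbrev U (n : ℕ) : Type := ↥(Matrix.unitaryGroup (Fin n) ℂ)

/-- The `p`-Schatten norm `Tr (|x| ^ p) ^ (1 / p) = Tr ((x* x) ^ (p / 2)) ^ (1 / p)` of a complex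
matrix, for an even integer `p ≥ 2`, so that the exponent `p / 2` is a natural number and the
matrix power is the usual one. The trace is a nonnegative real number, whence the real part. -/
def schattenNorm {n : ℕ} (p : ℕ) (x : Matrix (Fin n) (Fin n) ℂ) : ℝ :=
  (((xᴴ * x) ^ (p / 2)).trace.re) ^ (1 / (p : ℝ))

/-- The curve of matrices underlying a curve in `U_n`. -/
def toMatrixCurve {n : ℕ} (γ : ℝ → U n) (t : ℝ) : Matrix (Fin n) (Fin n) ℂ :=
  (γ t : Matrix (Fin n) (Fin n) ℂ)

/-- `γ`, restricted to `[0, 1]`, is a piecewise smooth curve in `U_n`: it is continuous and there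
is a partition `0 = τ 0 < τ 1 < ⋯ < τ m = 1` such that `γ` is `C^∞` on each closed
subinterval. The values of `γ` outside of `[0, 1]` play no role, neither here nor below. -/
def PiecewiseSmooth {n : ℕ} (γ : ℝ → U n) : Prop :=
  ContinuousOn (toMatrixCurve γ) (Set.Icc 0 1) ∧
    ∃ (m : ℕ) (τ : ℕ → ℝ), τ 0 = 0 ∧ τ m = 1 ∧
      ∀ i < m, τ i < τ (i + 1) ∧
        ContDiffOn ℝ ∞ (toMatrixCurve γ) (Set.Icc (τ i) (τ (i + 1)))

/-- `γ : [0, 1] → U_n` is a piecewise smooth curve from `u` to `v`. -/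
structure Joins {n : ℕ} (γ : ℝ → U n) (u v : U n) : Prop where
  piecewiseSmooth : PiecewiseSmooth γ
  source : γ 0 = u
  target : γ 1 = v

/-- The length `L_p(γ) = ∫₀¹ ‖γ'(t)‖_p dt` (the derivative is taken in the space of matrices; it
exists outside of a finite set when `γ` is piecewise smooth). -/
def curveLength {n : ℕ} (p : ℕ) (γ : ℝ → U n) : ℝ :=
  ∫ t in (0 : ℝ)..1, schattenNorm p (deriv (toMatrixCurve γ) t)

/-- The rectifiable distance `d_p` in `U_n`: the infimum of the lengths of the piecewise smooth
curves in `U_n` that join the two points. -/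
def rectDist {n : ℕ} (p : ℕ) (u v : U n) : ℝ :=
  sInf {L : ℝ | ∃ γ : ℝ → U n, Joins γ u v ∧ curveLength p γ = L}

/-- The open ball `B_p(u, r)`. -/
def openBall {n : ℕ} (p : ℕ) (u : U n) (r : ℝ) : Set (U n) := {v | rectDist p u v < r}

/-- The closed ball `B_p[u, r]`. -/
def closedBall {n : ℕ} (p : ℕ) (u : U n) (r : ℝ) : Set (U n) := {v | rectDist p u v ≤ r}

/-- A geodesic joining `u` and `v` in the metric space `(U_n, d_p)`: a piecewise smooth curve from
`u` to `v` that is length minimizing, that is, whose length is `d_p(u, v)`. -/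
structure IsGeodesic {n : ℕ} (p : ℕ) (γ : ℝ → U n) (u v : U n) : Prop where
  joins : Joins γ u v
  minimal : curveLength p γ = rectDist p u v

/-- `M ⊆ U_n` is geodesically convex: any two points of `M` are joined by a geodesic that is
contained in `M`. -/
def GeodesicallyConvex {n : ℕ} (p : ℕ) (M : Set (U n)) : Prop :=
  ∀ u ∈ M, ∀ v ∈ M, ∃ γ : ℝ → U n, IsGeodesic p γ u v ∧ ∀ t ∈ Set.Icc (0 : ℝ) 1, γ t ∈ M

end FinslerUnitary

end

/-!
Let `v` be unitary with eigenvalues `exp (i θ_j)`, `|θ_j| ≤ π`. The proof rests on the formula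
`d_p(u, u v) = (∑ |θ_j| ^ p) ^ (1 / p)` (`rectDist_mul_conjExp`) and on a midpoint inequality for
its `p`-th power (`sum_abs_pow_midpoint_le`).

The one-parameter curve `t ↦ u v ^ t` has the length claimed, so the formula is a lower bound for
the lengths of all curves. Let `k` be a real polynomial such that `θ ↦ k (cos θ)` vanishes at `0`
and is `1`-Lipschitz. Along a curve `η` of unitaries starting at `1`, the function
`F = Tr (k (Re η) ^ p)` is differentiable, since the trace of a polynomial is differentiated as in
the commutative case, and Hölder's inequality gives `|F'| ≤ p F ^ (1 - 1 / p) ‖η'‖_p`. Hence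
`F ^ (1 / p)` grows by at most the length (`angleTrace_rpow_le_integral`). At `η = v` its value is
`(∑ |k (cos θ_j)| ^ p) ^ (1 / p)`, and `k` may be chosen with `k (cos θ_j)` as close to `|θ_j|` as
desired (`exists_seq_isAnglePolynomial`). No smooth choice of eigenvalues along the curve is needed,
and closed balls come out as intersections of sublevel sets of continuous functions.

For the convexity of balls, let `m` be the midpoint of a geodesic from `v = m exp (-i y)` to
`w = m exp (i y)`, where `‖y‖ ≤ π / 2`, and let `m` have eigenvectors `ξ_j` and eigenvalues
`exp (i φ_j)`. As `(v + w) / 2 = m cos y`, the mean of the real numbers `a_j = ⟪Re v ξ_j, ξ_j⟫` and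
`b_j = ⟪Re w ξ_j, ξ_j⟫` is `cos φ_j ⟪cos y ξ_j, ξ_j⟫`. If the arguments of `v` and `w` are at most
`R < π / 2`, then `a_j` and `b_j` are positive, so that `cos φ_j ≥ (a_j + b_j) / 2`. The function
`arccos ^ p` is decreasing and convex on `[0, 1]`, and Peierls' inequality
(`sum_convex_diag_le`) bounds `∑ arccos (a_j) ^ p` by the sum of the `p`-th powers of the arguments
of `v`. So `d_p(u, ·) ^ p` at the midpoint is at most the mean of its values at the endpoints.
A closed ball of radius less than `π / 2` therefore contains, with two points of a geodesic at
parameters in `[0, 1]`, the one halfway between them, and being closed it contains all of the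
geodesic.

In `U_1` a curve joining `u exp (i x)` and `u exp (-i x)`, `π / 2 < x < π`, that avoids the antipode
`-u` runs through `u` and has length at least `2 x`, whereas the distance is `2 π - 2 x`.
-/

namespace FinslerUnitary

/-! ### Spectral decomposition and Peierls' inequality -/

section

open Matrix

variable {n : ℕ}

/-- The matrix `W diag(d) Wᴴ`, for a unitary `W`, as an algebra homomorphism in `d`. -/
noncomputable def conjDiag (W : U n) : (Fin n → ℂ) →ₐ[ℂ] Matrix (Fin n) (Fin n) ℂ :=
  (Unitary.conjStarAlgAut ℂ (Matrix (Fin n) (Fin n) ℂ) W).toAlgEquiv.toAlgHom.comp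
    (Matrix.diagonalAlgHom ℂ)

theorem conjDiag_apply (W : U n) (d : Fin n → ℂ) :
    conjDiag W d = (W : Matrix (Fin n) (Fin n) ℂ) * diagonal d * (W : Matrix (Fin n) (Fin n) ℂ)ᴴ :=
  rfl

theorem conjTranspose_mul_self_coe (W : U n) :
    (W : Matrix (Fin n) (Fin n) ℂ)ᴴ * (W : Matrix (Fin n) (Fin n) ℂ) = 1 :=
  Unitary.coe_star_mul_self W

theorem self_mul_conjTranspose_coe (W : U n) :
    (W : Matrix (Fin n) (Fin n) ℂ) * (W : Matrix (Fin n) (Fin n) ℂ)ᴴ = 1 :=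
  Unitary.coe_mul_star_self W

theorem conjTranspose_conjDiag (W : U n) (d : Fin n → ℂ) :
    (conjDiag W d)ᴴ = conjDiag W (star d) := by
  simp [conjDiag_apply, Matrix.mul_assoc]

theorem trace_conjDiag (W : U n) (d : Fin n → ℂ) : (conjDiag W d).trace = ∑ j, d j := by
  rw [conjDiag_apply, Matrix.trace_mul_cycle, conjTranspose_mul_self_coe, one_mul, trace_diagonal]

theorem conj_conjDiag_self (W : U n) (d : Fin n → ℂ) :
    (W : Matrix (Fin n) (Fin n) ℂ)ᴴ * conjDiag W d * (W : Matrix (Fin n) (Fin n) ℂ)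
      = diagonal d := by
  rw [conjDiag_apply]
  calc _ = ((W : Matrix (Fin n) (Fin n) ℂ)ᴴ * (W : Matrix (Fin n) (Fin n) ℂ)) * diagonal d *
        ((W : Matrix (Fin n) (Fin n) ℂ)ᴴ * (W : Matrix (Fin n) (Fin n) ℂ)) := by
          simp only [Matrix.mul_assoc]
    _ = _ := by simp [conjTranspose_mul_self_coe]

theorem aeval_conjDiag (W : U n) (d : Fin n → ℝ) (k : Polynomial ℝ) :
    Polynomial.aeval (conjDiag W fun j => (d j : ℂ)) k
      = conjDiag W fun j => ((k.eval (d j) : ℝ) : ℂ) := by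
  have h := Polynomial.aeval_algHom_apply ((conjDiag W).restrictScalars ℝ)
    (fun j => (d j : ℂ)) k
  refine h.trans (congrArg (conjDiag W) (funext fun j => ?_))
  have h2 := Polynomial.aeval_algHom_apply (Pi.evalAlgHom ℝ (fun _ : Fin n => ℂ) j)
    (fun j => (d j : ℂ)) k
  refine h2.symm.trans ?_
  exact Polynomial.aeval_algebraMap_apply_eq_algebraMap_eval (A := ℂ) (d j) k

theorem exists_conjDiag_of_isHermitian {H : Matrix (Fin n) (Fin n) ℂ} (hH : H.IsHermitian) :
    ∃ (W : U n) (d : Fin n → ℝ), H = conjDiag W fun j => (d j : ℂ) :=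
  ⟨hH.eigenvectorUnitary, hH.eigenvalues, hH.spectral_theorem⟩

/-- Spectral theorem for unitary matrices, with eigenvalue arguments in `[-π, π]`. -/
theorem exists_conjDiag_of_unitary (v : U n) :
    ∃ (W : U n) (θ : Fin n → ℝ), (∀ j, |θ j| ≤ Real.pi) ∧
      (v : Matrix (Fin n) (Fin n) ℂ) = conjDiag W fun j => Complex.exp (θ j * Complex.I) := by
  -- The spectrum is finite, so that `arg` is continuous on it.
  have hfin : (spectrum ℂ (v : Matrix (Fin n) (Fin n) ℂ)).Finite := Matrix.finite_spectrum _
  have hc : ∀ f : ℂ → ℂ, ContinuousOn f (spectrum ℂ (v : Matrix (Fin n) (Fin n) ℂ)) :=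
    fun f => hfin.continuousOn f
  have hn : IsStarNormal (v : Matrix (Fin n) (Fin n) ℂ) := (Unitary.coe_isStarNormal v)
  obtain ⟨W, θ, hθ⟩ := exists_conjDiag_of_isHermitian
    (IsSelfAdjoint.cfc_arg (v : Matrix (Fin n) (Fin n) ℂ))
  have hv : (v : Matrix (Fin n) (Fin n) ℂ)
      = NormedSpace.exp (Complex.I • cfc (Complex.ofReal ∘ Complex.arg : ℂ → ℂ)
        (v : Matrix (Fin n) (Fin n) ℂ)) := by
    rw [← cfc_smul Complex.I _ _ (hc _), ← CFC.exp_eq_normedSpace_exp (𝕜 := ℂ),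
      ← cfc_comp' (g := NormedSpace.exp) (ha := hn) (hf := hc _)
        (hg := by rw [← Complex.exp_eq_exp_ℂ]; exact Complex.continuous_exp.continuousOn)]
    conv_lhs => rw [← cfc_id' ℂ (v : Matrix (Fin n) (Fin n) ℂ)]
    refine cfc_congr fun y hy => ?_
    have hy₁ : ‖y‖ = 1 := spectrum.norm_eq_one_of_unitary v.2 hy
    rw [← Complex.exp_eq_exp_ℂ]
    have := Complex.norm_mul_exp_arg_mul_I y
    rw [hy₁, Complex.ofReal_one, one_mul] at this
    simpa [mul_comm] using this.symm
  have hcont : Continuous (conjDiag W) :=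
    LinearMap.continuous_of_finiteDimensional (conjDiag W).toLinearMap
  refine ⟨W, fun j => (Complex.exp (θ j * Complex.I)).arg, fun j => Complex.abs_arg_le_pi _, ?_⟩
  rw [hv, hθ, ← map_smul, ← NormedSpace.map_exp (conjDiag W) hcont]
  refine congrArg (conjDiag W) (funext fun j => ?_)
  have := Complex.norm_mul_exp_arg_mul_I (Complex.exp (θ j * Complex.I))
  rw [Complex.norm_exp_ofReal_mul_I, Complex.ofReal_one, one_mul] at this
  rw [this, Pi.coe_exp, ← Complex.exp_eq_exp_ℂ]
  simp [mul_comm]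

theorem diag_entry (Q : Matrix (Fin n) (Fin n) ℂ) (d : Fin n → ℂ) (j : Fin n) :
    (Q * diagonal d * Qᴴ) j j = ∑ k, ((‖Q j k‖ ^ 2 : ℝ) : ℂ) * d k := by
  rw [Matrix.mul_apply]
  refine Finset.sum_congr rfl fun k _ => ?_
  rw [Matrix.mul_diagonal, conjTranspose_apply, mul_right_comm, RCLike.star_def,
    Complex.mul_conj, Complex.normSq_eq_norm_sq]

theorem sum_row_norm_sq (Q : U n) (j : Fin n) :
    ∑ k, ‖(Q : Matrix (Fin n) (Fin n) ℂ) j k‖ ^ 2 = 1 := by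
  have h := diag_entry (Q : Matrix (Fin n) (Fin n) ℂ) (fun _ => 1) j
  rw [diagonal_one, mul_one, self_mul_conjTranspose_coe] at h
  simp only [Matrix.one_apply_eq, mul_one] at h
  exact_mod_cast h.symm

theorem sum_col_norm_sq (Q : U n) (k : Fin n) :
    ∑ j, ‖(Q : Matrix (Fin n) (Fin n) ℂ) j k‖ ^ 2 = 1 := by
  have h := sum_row_norm_sq (star Q) k
  simpa [Matrix.star_apply] using h

/-- The diagonal entries of `conjDiag V d` in the orthonormal basis `W` are averages of `d`. -/
theorem conj_conjDiag_diag (W V : U n) (d : Fin n → ℝ) (j : Fin n) :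
    ((W : Matrix (Fin n) (Fin n) ℂ)ᴴ * conjDiag V (fun k => (d k : ℂ)) *
      (W : Matrix (Fin n) (Fin n) ℂ)) j j
    = ((∑ k, ‖((star W * V : U n) : Matrix (Fin n) (Fin n) ℂ) j k‖ ^ 2 * d k : ℝ) : ℂ) := by
  have h := diag_entry ((star W * V : U n) : Matrix (Fin n) (Fin n) ℂ) (fun k => (d k : ℂ)) j
  have e : (W : Matrix (Fin n) (Fin n) ℂ)ᴴ * conjDiag V (fun k => (d k : ℂ)) *
      (W : Matrix (Fin n) (Fin n) ℂ) = ((star W * V : U n) : Matrix (Fin n) (Fin n) ℂ) *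
      diagonal (fun k => (d k : ℂ)) * ((star W * V : U n) : Matrix (Fin n) (Fin n) ℂ)ᴴ := by
    simp [conjDiag_apply, Matrix.mul_assoc, Matrix.star_eq_conjTranspose]
  rw [e, h]
  push_cast
  rfl

theorem conj_conjDiag_diag_mem (W V : U n) (d : Fin n → ℝ) {s : Set ℝ} (hs : Convex ℝ s)
    (hd : ∀ k, d k ∈ s) (j : Fin n) :
    (((W : Matrix (Fin n) (Fin n) ℂ)ᴴ * conjDiag V (fun k => (d k : ℂ)) *
      (W : Matrix (Fin n) (Fin n) ℂ)) j j).re ∈ s := by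
  rw [conj_conjDiag_diag, Complex.ofReal_re]
  exact hs.sum_mem (fun k _ => by positivity) (sum_row_norm_sq _ j) fun k _ => hd k

/-- **Peierls' inequality**: a convex trace functional decreases when a Hermitian matrix is
replaced by its diagonal part in some orthonormal basis. -/
theorem sum_convex_diag_le (W V : U n) (d : Fin n → ℝ) {s : Set ℝ} {g : ℝ → ℝ}
    (hg : ConvexOn ℝ s g) (hd : ∀ k, d k ∈ s) :
    ∑ j, g (((W : Matrix (Fin n) (Fin n) ℂ)ᴴ * conjDiag V (fun k => (d k : ℂ)) *
      (W : Matrix (Fin n) (Fin n) ℂ)) j j).re ≤ ∑ k, g (d k) := by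
  calc _ ≤ ∑ j, ∑ k, ‖((star W * V : U n) : Matrix (Fin n) (Fin n) ℂ) j k‖ ^ 2 * g (d k) := by
        refine Finset.sum_le_sum fun j _ => ?_
        rw [conj_conjDiag_diag, Complex.ofReal_re]
        exact hg.map_sum_le (fun k _ => by positivity) (sum_row_norm_sq _ j) fun k _ => hd k
    _ = ∑ k, g (d k) := by
        rw [Finset.sum_comm]
        refine Finset.sum_congr rfl fun k _ => ?_
        rw [← Finset.sum_mul, sum_col_norm_sq, one_mul]

end

/-! ### Schatten norms and Hölder's inequality -/

section

open Matrix

variable {n : ℕ} {p : ℕ}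

open scoped ComplexOrder in
theorem exists_conjTranspose_mul_self_eq_conjDiag (x : Matrix (Fin n) (Fin n) ℂ) :
    ∃ (V : U n) (d : Fin n → ℝ), (∀ k, 0 ≤ d k) ∧ xᴴ * x = conjDiag V fun k => (d k : ℂ) :=
  ⟨_, _, (posSemidef_conjTranspose_mul_self x).eigenvalues_nonneg,
    (posSemidef_conjTranspose_mul_self x).1.spectral_theorem⟩

theorem trace_conjDiag_ofReal_pow (V : U n) (d : Fin n → ℝ) (m : ℕ) :
    (((conjDiag V fun k => (d k : ℂ)) ^ m).trace).re = ∑ k, d k ^ m := by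
  rw [← map_pow, trace_conjDiag, Complex.re_sum]
  refine Finset.sum_congr rfl fun k _ => ?_
  rw [Pi.pow_apply, ← Complex.ofReal_pow, Complex.ofReal_re]

theorem trace_pow_conjTranspose_mul_self_nonneg (x : Matrix (Fin n) (Fin n) ℂ) (m : ℕ) :
    0 ≤ (((xᴴ * x) ^ m).trace).re := by
  obtain ⟨V, d, hd, h⟩ := exists_conjTranspose_mul_self_eq_conjDiag x
  rw [h, trace_conjDiag_ofReal_pow]
  exact Finset.sum_nonneg fun k _ => pow_nonneg (hd k) _

theorem schattenNorm_nonneg (x : Matrix (Fin n) (Fin n) ℂ) : 0 ≤ schattenNorm p x :=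
  Real.rpow_nonneg (trace_pow_conjTranspose_mul_self_nonneg x _) _

theorem schattenNorm_unitary_mul (u : U n) (x : Matrix (Fin n) (Fin n) ℂ) :
    schattenNorm p ((u : Matrix (Fin n) (Fin n) ℂ) * x) = schattenNorm p x := by
  have h : ((u : Matrix (Fin n) (Fin n) ℂ) * x)ᴴ * ((u : Matrix (Fin n) (Fin n) ℂ) * x)
      = xᴴ * x := by
    rw [conjTranspose_mul, Matrix.mul_assoc, ← Matrix.mul_assoc _ _ x, conjTranspose_mul_self_coe,
      Matrix.one_mul]
  rw [schattenNorm, h, schattenNorm]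

theorem schattenNorm_conjDiag (hp : Even p) (W : U n) (d : Fin n → ℂ) :
    schattenNorm p (conjDiag W d) = (∑ j, ‖d j‖ ^ p) ^ (1 / (p : ℝ)) := by
  have h : (conjDiag W d)ᴴ * conjDiag W d = conjDiag W fun j => ((‖d j‖ ^ 2 : ℝ) : ℂ) := by
    rw [conjTranspose_conjDiag, ← map_mul]
    refine congrArg _ (funext fun j => ?_)
    rw [Pi.mul_apply, Pi.star_apply, mul_comm, RCLike.star_def, Complex.mul_conj,
      Complex.normSq_eq_norm_sq]
  rw [schattenNorm, h, trace_conjDiag_ofReal_pow]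
  simp only [← pow_mul, Nat.two_mul_div_two_of_even hp]

theorem continuous_schattenNorm (hp2 : 2 ≤ p) :
    Continuous (schattenNorm p : Matrix (Fin n) (Fin n) ℂ → ℝ) := by
  have h : Continuous fun x : Matrix (Fin n) (Fin n) ℂ => (((xᴴ * x) ^ (p / 2)).trace).re :=
    Complex.continuous_re.comp <| Continuous.matrix_trace <|
      ((continuous_id.matrix_conjTranspose).mul continuous_id).pow _
  exact h.rpow_const fun _ => Or.inr (by positivity)

/-- The `ℓ^p` norm of the diagonal, in any orthonormal basis, is at most the Schatten norm. -/
theorem sum_norm_diag_pow_le (hp : Even p) (W : U n) (x : Matrix (Fin n) (Fin n) ℂ) :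
    ∑ j, ‖((W : Matrix (Fin n) (Fin n) ℂ)ᴴ * x * (W : Matrix (Fin n) (Fin n) ℂ)) j j‖ ^ p
      ≤ (((xᴴ * x) ^ (p / 2)).trace).re := by
  obtain ⟨V, d, hd, h⟩ := exists_conjTranspose_mul_self_eq_conjDiag x
  rw [h, trace_conjDiag_ofReal_pow]
  refine le_trans (Finset.sum_le_sum fun j _ => ?_)
    (sum_convex_diag_le W V d (convexOn_pow (p / 2)) fun k => hd k)
  set y := (W : Matrix (Fin n) (Fin n) ℂ)ᴴ * x * (W : Matrix (Fin n) (Fin n) ℂ) with hy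
  have e : (W : Matrix (Fin n) (Fin n) ℂ)ᴴ * conjDiag V (fun k => (d k : ℂ)) *
      (W : Matrix (Fin n) (Fin n) ℂ) = yᴴ * y := by
    rw [← h, hy]
    simp only [conjTranspose_mul, conjTranspose_conjTranspose]
    calc _ = (W : Matrix (Fin n) (Fin n) ℂ)ᴴ * xᴴ * 1 * x * (W : Matrix (Fin n) (Fin n) ℂ) := by
          simp only [Matrix.mul_assoc, Matrix.one_mul]
      _ = _ := by
          rw [← self_mul_conjTranspose_coe W]
          simp only [Matrix.mul_assoc]
  have e2 : ((yᴴ * y) j j).re = ∑ i, ‖y i j‖ ^ 2 := by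
    rw [Matrix.mul_apply, Complex.re_sum]
    refine Finset.sum_congr rfl fun i _ => ?_
    rw [conjTranspose_apply, mul_comm, RCLike.star_def, Complex.mul_conj, Complex.ofReal_re,
      Complex.normSq_eq_norm_sq]
  rw [e, e2]
  calc ‖y j j‖ ^ p = (‖y j j‖ ^ 2) ^ (p / 2) := by
        rw [← pow_mul, Nat.two_mul_div_two_of_even hp]
    _ ≤ _ := by
        refine pow_le_pow_left₀ (by positivity) ?_ _
        exact Finset.single_le_sum (f := fun i => ‖y i j‖ ^ 2) (fun i _ => by positivity)
          (Finset.mem_univ j)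

/-- Hölder's inequality for the trace, against a matrix that is diagonal in a known basis. -/
theorem norm_trace_conjDiag_mul_le (hp : Even p) (hp2 : 2 ≤ p) (W : U n) (c : Fin n → ℂ)
    (s : Fin n → ℝ) (hs : ∀ j, 0 ≤ s j) (hc : ∀ j, ‖c j‖ ≤ s j ^ (p - 1))
    (x : Matrix (Fin n) (Fin n) ℂ) :
    ‖(conjDiag W c * x).trace‖ ≤ (∑ j, s j ^ p) ^ (1 - 1 / (p : ℝ)) * schattenNorm p x := by
  set y := (W : Matrix (Fin n) (Fin n) ℂ)ᴴ * x * (W : Matrix (Fin n) (Fin n) ℂ) with hy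
  have e : (conjDiag W c * x).trace = ∑ j, c j * y j j := by
    rw [conjDiag_apply, Matrix.mul_assoc, Matrix.mul_assoc, Matrix.trace_mul_comm, Matrix.mul_assoc,
      ← hy, Matrix.trace]
    simp [Matrix.diagonal_mul]
  have hp1 : (1 : ℝ) < p := by exact_mod_cast hp2
  have hpq := Real.HolderConjugate.conjExponent hp1
  have hq : 1 / Real.conjExponent p = 1 - 1 / (p : ℝ) := by
    have := hpq.inv_add_inv_eq_one
    simp only [one_div]
    linarith
  have hpow : ∀ j, (s j ^ (p - 1)) ^ Real.conjExponent p = s j ^ p := fun j => by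
    have h0 : (p : ℝ) - 1 ≠ 0 := by linarith
    rw [← Real.rpow_natCast (s j) (p - 1), ← Real.rpow_mul (hs j), ← Real.rpow_natCast,
      Nat.cast_sub (by omega), Real.conjExponent]
    congr 1
    push_cast
    field_simp
  rw [e]
  calc ‖∑ j, c j * y j j‖ ≤ ∑ j, s j ^ (p - 1) * ‖y j j‖ := by
        refine (norm_sum_le _ _).trans (Finset.sum_le_sum fun j _ => ?_)
        rw [norm_mul]
        gcongr
        exact hc j
    _ ≤ (∑ j, (s j ^ (p - 1)) ^ Real.conjExponent p) ^ (1 / Real.conjExponent p) *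
          (∑ j, ‖y j j‖ ^ (p : ℝ)) ^ (1 / (p : ℝ)) :=
        Real.inner_le_Lp_mul_Lq_of_nonneg _ hpq.symm (fun j _ => pow_nonneg (hs j) _)
          fun j _ => norm_nonneg _
    _ ≤ _ := by
        simp only [hpow, hq, Real.rpow_natCast]
        refine mul_le_mul_of_nonneg_left ?_
          (Real.rpow_nonneg (Finset.sum_nonneg fun j _ => pow_nonneg (hs j) _) _)
        exact Real.rpow_le_rpow (Finset.sum_nonneg fun j _ => by positivity)
          (sum_norm_diag_pow_le hp W x) (by positivity)

end

/-! ### Polynomial approximation and convexity of the arc cosine -/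

section

open Set Filter Topology

theorem exists_polynomial_derivative_eq (q : Polynomial ℝ) :
    ∃ Q : Polynomial ℝ, Polynomial.derivative Q = q := by
  induction q using Polynomial.induction_on' with
  | add q r hq hr =>
    obtain ⟨Q, rfl⟩ := hq
    obtain ⟨R, rfl⟩ := hr
    exact ⟨Q + R, Polynomial.derivative_add⟩
  | monomial m a =>
    refine ⟨Polynomial.monomial (m + 1) (a / (m + 1)), ?_⟩
    rw [Polynomial.derivative_monomial, Nat.add_sub_cancel]
    congr 1
    push_cast
    field_simp

/-- Polynomials `k` for which `θ ↦ k (cos θ)` vanishes at `0` and is `1`-Lipschitz. -/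
def IsAnglePolynomial (k : Polynomial ℝ) : Prop :=
  k.eval 1 = 0 ∧ ∀ θ : ℝ, |k.derivative.eval (Real.cos θ) * Real.sin θ| ≤ 1

/-- The derivative of `-k` approximates the one of `x ↦ arcsin (c * x)`, which is continuous on
`[-1, 1]` for `c < 1` and leaves a margin `1 - c` in the Lipschitz bound. -/
theorem exists_isAnglePolynomial_near {c : ℝ} (hc0 : 0 < c) (hc1 : c < 1) :
    ∃ k : Polynomial ℝ, IsAnglePolynomial k ∧ ∀ x ∈ Icc (-1 : ℝ) 1,
      |k.eval x - (Real.arcsin c - Real.arcsin (c * x))| ≤ 2 * (1 - c) := by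
  have hpos : ∀ x ∈ Icc (-1 : ℝ) 1, 0 < 1 - (c * x) ^ 2 := fun x hx => by
    have h1 : x ^ 2 ≤ 1 := by nlinarith [hx.1, hx.2]
    have h2 : c ^ 2 < 1 := by nlinarith
    rw [mul_pow]
    nlinarith [sq_nonneg x]
  have hder : ∀ x ∈ Icc (-1 : ℝ) 1,
      HasDerivAt (fun x => Real.arcsin (c * x)) (c / √(1 - (c * x) ^ 2)) x := fun x hx => by
    have h1 : c * x ≠ -1 := by nlinarith [hx.1, hx.2]
    have h2 : c * x ≠ 1 := by nlinarith [hx.1, hx.2]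
    have := (Real.hasDerivAt_arcsin h1 h2).comp x ((hasDerivAt_id x).const_mul c)
    refine this.congr_deriv ?_
    ring
  have hcont : ContinuousOn (fun x : ℝ => c / √(1 - (c * x) ^ 2)) (Icc (-1) 1) :=
    continuousOn_const.div (by fun_prop) fun x hx => (Real.sqrt_pos.2 (hpos x hx)).ne'
  obtain ⟨q, hq⟩ := exists_polynomial_near_of_continuousOn (-1) 1 _ hcont (1 - c) (by linarith)
  obtain ⟨Q, hQ⟩ := exists_polynomial_derivative_eq q
  refine ⟨Polynomial.C (Q.eval 1) - Q, ⟨by simp, fun θ => ?_⟩, fun x hx => ?_⟩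
  · have hmem : Real.cos θ ∈ Icc (-1 : ℝ) 1 := ⟨Real.neg_one_le_cos θ, Real.cos_le_one θ⟩
    have hs : |Real.sin θ| ≤ 1 := Real.abs_sin_le_one θ
    have hr := Real.sqrt_pos.2 (hpos _ hmem)
    have hsr : |Real.sin θ| ≤ √(1 - (c * Real.cos θ) ^ 2) := by
      refine Real.abs_le_sqrt ?_
      have h2 : c ^ 2 ≤ 1 := by nlinarith
      rw [mul_pow]
      nlinarith [Real.sin_sq_add_cos_sq θ, sq_nonneg (Real.cos θ)]
    have h1 : |c / √(1 - (c * Real.cos θ) ^ 2)| * |Real.sin θ| ≤ c := by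
      rw [abs_of_pos (by positivity), div_mul_eq_mul_div, div_le_iff₀ hr]
      gcongr
    have h2 := hq _ hmem
    have h3 : |q.eval (Real.cos θ)|
        ≤ (1 - c) + |c / √(1 - (c * Real.cos θ) ^ 2)| := by
      have := abs_add_le (q.eval (Real.cos θ) - c / √(1 - (c * Real.cos θ) ^ 2))
        (c / √(1 - (c * Real.cos θ) ^ 2))
      rw [sub_add_cancel] at this
      linarith
    rw [Polynomial.derivative_sub, Polynomial.derivative_C, zero_sub, hQ, Polynomial.eval_neg,
      neg_mul, abs_neg, abs_mul]
    nlinarith [abs_nonneg (Real.sin θ)]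
  · have hg : ∀ y ∈ Icc (-1 : ℝ) 1, HasDerivWithinAt
        (fun y => Q.eval y - Real.arcsin (c * y)) (q.eval y - c / √(1 - (c * y) ^ 2))
        (Icc (-1) 1) y := fun y hy => by
      have := (Q.hasDerivAt y).sub (hder y hy)
      rw [hQ] at this
      exact this.hasDerivWithinAt
    have := (convex_Icc (-1 : ℝ) 1).norm_image_sub_le_of_norm_hasDerivWithin_le hg
      (fun y hy => (hq y hy).le) hx (right_mem_Icc.2 (by norm_num))
    rw [Real.norm_eq_abs, Real.norm_eq_abs, mul_one,
      abs_of_nonneg (a := 1 - x) (by linarith [hx.2])] at this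
    rw [Polynomial.eval_sub, Polynomial.eval_C]
    calc _ = |Q.eval 1 - Real.arcsin c - (Q.eval x - Real.arcsin (c * x))| := by
          congr 1; ring
      _ ≤ (1 - c) * (1 - x) := this
      _ ≤ _ := by nlinarith [hx.1]

theorem exists_seq_isAnglePolynomial : ∃ k : ℕ → Polynomial ℝ, (∀ N, IsAnglePolynomial (k N)) ∧
    ∀ x ∈ Icc (-1 : ℝ) 1, Tendsto (fun N => (k N).eval x) atTop (𝓝 (Real.arccos x)) := by
  have hc : ∀ N : ℕ, 0 < 1 - 1 / ((N : ℝ) + 2) ∧ 1 - 1 / ((N : ℝ) + 2) < 1 := fun N => by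
    have : (0 : ℝ) < (N : ℝ) + 2 := by positivity
    have h2 : 1 / ((N : ℝ) + 2) < 1 := by
      rw [div_lt_one this]
      linarith [(Nat.cast_nonneg N : (0 : ℝ) ≤ N)]
    have h3 : 0 < 1 / ((N : ℝ) + 2) := by positivity
    constructor <;> linarith
  choose k hk hk' using fun N => exists_isAnglePolynomial_near (hc N).1 (hc N).2
  refine ⟨k, hk, fun x hx => ?_⟩
  have hlim : Tendsto (fun N : ℕ => 1 - 1 / ((N : ℝ) + 2)) atTop (𝓝 1) := by
    have := (tendsto_one_div_add_atTop_nhds_zero_nat (𝕜 := ℝ)).comp (tendsto_add_atTop_nat 1)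
    have h2 := this.const_sub 1
    rw [sub_zero] at h2
    refine h2.congr fun N => ?_
    simp only [Function.comp_apply]
    push_cast
    ring_nf
  have h1 : Tendsto (fun N : ℕ => Real.arcsin (1 - 1 / ((N : ℝ) + 2)) -
      Real.arcsin ((1 - 1 / ((N : ℝ) + 2)) * x)) atTop (𝓝 (Real.arccos x)) := by
    have a := (Real.continuous_arcsin.tendsto 1).comp hlim
    have b := (Real.continuous_arcsin.tendsto (1 * x)).comp (hlim.mul_const x)
    have := a.sub b
    rwa [Real.arcsin_one, one_mul, ← Real.arccos_eq_pi_div_two_sub_arcsin] at this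
  have h2 : Tendsto (fun N : ℕ => (k N).eval x - (Real.arcsin (1 - 1 / ((N : ℝ) + 2)) -
      Real.arcsin ((1 - 1 / ((N : ℝ) + 2)) * x))) atTop (𝓝 0) := by
    refine squeeze_zero_norm (fun N => hk' N x hx) ?_
    have := (hlim.const_sub 1).const_mul 2
    simpa using this
  simpa using h2.add h1

theorem antitoneOn_sinc : AntitoneOn Real.sinc (Icc 0 Real.pi) := by
  intro a ha b hb hab
  rcases ha.1.eq_or_lt with rfl | ha0
  · rw [Real.sinc_zero]; exact Real.sinc_le_one b
  have hb0 := ha0.trans_le hab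
  rw [Real.sinc_of_ne_zero hb0.ne', Real.sinc_of_ne_zero ha0.ne', div_le_div_iff₀ hb0 ha0]
  have := strictConcaveOn_sin_Icc.concaveOn.2 hb (left_mem_Icc.2 Real.pi_pos.le)
    (div_nonneg ha0.le hb0.le) (sub_nonneg.2 ((div_le_one hb0).2 hab)) (by ring)
  simp only [smul_eq_mul, Real.sin_zero, mul_zero, add_zero, div_mul_cancel₀ _ hb0.ne'] at this
  rw [div_mul_eq_mul_div, div_le_iff₀ hb0] at this
  linarith

theorem convexOn_arccos_sq : ConvexOn ℝ (Icc (-1) 1) fun x => Real.arccos x ^ 2 := by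
  have hd : ∀ x ∈ Ioo (-1 : ℝ) 1,
      HasDerivAt (fun x => Real.arccos x ^ 2) (-2 / Real.sinc (Real.arccos x)) x := fun x hx => by
    have h := (Real.hasDerivAt_arccos hx.1.ne' hx.2.ne).pow 2
    refine h.congr_deriv ?_
    have h0 : Real.arccos x ≠ 0 := (Real.arccos_pos.2 hx.2).ne'
    rw [Real.sinc_of_ne_zero h0, Real.sin_arccos]
    rw [neg_div, div_div_eq_mul_div]
    push_cast
    ring
  refine MonotoneOn.convexOn_of_deriv (convex_Icc _ _) (by fun_prop) ?_ ?_
  · rw [interior_Icc]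
    exact fun x hx => (hd x hx).differentiableAt.differentiableWithinAt
  · rw [interior_Icc]
    intro x hx y hy hxy
    rw [(hd x hx).deriv, (hd y hy).deriv]
    have hpos : ∀ z ∈ Ioo (-1 : ℝ) 1, 0 < Real.sinc (Real.arccos z) := fun z hz => by
      have h0 := Real.arccos_pos.2 hz.2
      rw [Real.sinc_of_ne_zero h0.ne', Real.sin_arccos]
      exact div_pos (Real.sqrt_pos.2 (by nlinarith [hz.1, hz.2])) h0
    have hs : Real.sinc (Real.arccos x) ≤ Real.sinc (Real.arccos y) :=
      antitoneOn_sinc ⟨Real.arccos_nonneg _, Real.arccos_le_pi _⟩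
        ⟨Real.arccos_nonneg _, Real.arccos_le_pi _⟩ (Real.antitone_arccos hxy)
    rw [neg_div, neg_div, neg_le_neg_iff]
    exact div_le_div_of_nonneg_left (by norm_num) (hpos x hx) hs

theorem convexOn_arccos_pow {p : ℕ} (hp : Even p) :
    ConvexOn ℝ (Icc (-1) 1) fun x => Real.arccos x ^ p := by
  have := convexOn_arccos_sq.pow (fun x _ => sq_nonneg (Real.arccos x)) (p / 2)
  refine this.congr fun x _ => ?_
  simp only [Pi.pow_apply, ← pow_mul, Nat.two_mul_div_two_of_even hp]

end

/-! ### First variation of trace functionals along unitary curves -/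

section

open Matrix

variable {n : ℕ} {p : ℕ}

/-- The Hermitian part of a matrix. -/
noncomputable def hermPart (v : Matrix (Fin n) (Fin n) ℂ) : Matrix (Fin n) (Fin n) ℂ :=
  (2⁻¹ : ℂ) • (v + vᴴ)

/-- The trace of `k (Re v) ^ p`. For a unitary `v` with eigenvalues `exp (i θ_j)` this is
`∑ k (cos θ_j) ^ p`. -/
noncomputable def angleTrace (p : ℕ) (k : Polynomial ℝ) (v : Matrix (Fin n) (Fin n) ℂ) : ℝ :=
  ((Polynomial.aeval (hermPart v) (k ^ p)).trace).re

theorem hermPart_conjDiag (W : U n) (d : Fin n → ℂ) :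
    hermPart (conjDiag W d) = conjDiag W fun j => (((d j).re : ℝ) : ℂ) := by
  rw [hermPart, conjTranspose_conjDiag, ← map_add, ← map_smul]
  refine congrArg _ (funext fun j => ?_)
  rw [Complex.re_eq_add_conj]
  simp
  ring

theorem angleTrace_conjDiag (k : Polynomial ℝ) (W : U n) (θ : Fin n → ℝ) :
    angleTrace p k (conjDiag W fun j => Complex.exp (θ j * Complex.I))
      = ∑ j, k.eval (Real.cos (θ j)) ^ p := by
  simp only [angleTrace, hermPart_conjDiag, Complex.exp_ofReal_mul_I_re, aeval_conjDiag,
    trace_conjDiag, Complex.re_sum, Complex.ofReal_re, Polynomial.eval_pow]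

theorem angleTrace_nonneg (hp : Even p) (k : Polynomial ℝ) (v : U n) :
    0 ≤ angleTrace p k (v : Matrix (Fin n) (Fin n) ℂ) := by
  obtain ⟨W, θ, -, h⟩ := exists_conjDiag_of_unitary v
  rw [h, angleTrace_conjDiag]
  exact Finset.sum_nonneg fun j _ => hp.pow_nonneg _

theorem continuous_hermPart :
    Continuous (hermPart : Matrix (Fin n) (Fin n) ℂ → Matrix (Fin n) (Fin n) ℂ) :=
  (continuous_id.add continuous_id.matrix_conjTranspose).const_smul (2⁻¹ : ℂ)

theorem continuous_angleTrace (k : Polynomial ℝ) :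
    Continuous (angleTrace p k : Matrix (Fin n) (Fin n) ℂ → ℝ) :=
  Complex.continuous_re.comp <| Continuous.matrix_trace <|
    (Polynomial.continuous_aeval (k ^ p)).comp continuous_hermPart

/-- The derivative of the trace of a polynomial in a curve of matrices is the one of the
commutative case, because the trace is cyclic. -/
theorem hasDerivAt_trace_aeval {A : ℝ → Matrix (Fin n) (Fin n) ℂ} {A' : Matrix (Fin n) (Fin n) ℂ}
    {t : ℝ} (hA : HasDerivAt A A' t) (P : Polynomial ℝ) :
    HasDerivAt (fun s => (Polynomial.aeval (A s) P).trace)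
      ((Polynomial.aeval (A t) (Polynomial.derivative P) * A').trace) t := by
  let T : Matrix (Fin n) (Fin n) ℂ →L[ℝ] ℂ :=
    LinearMap.toContinuousLinearMap (Matrix.traceLinearMap (Fin n) ℝ ℂ)
  have hT : ∀ M, T M = M.trace := fun M => rfl
  induction P using Polynomial.induction_on' with
  | add q r hq hr =>
    simp only [map_add, trace_add, add_mul]
    exact hq.add hr
  | monomial m a =>
    have h := T.hasFDerivAt.comp_hasDerivAt t ((hA.fun_pow' m).const_smul a)
    have e : (fun s => (Polynomial.aeval (A s) (Polynomial.monomial m a)).trace)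
        = fun s => T (a • A s ^ m) := by
      funext s
      rw [Polynomial.aeval_monomial, ← Algebra.smul_def, hT]
    rw [e]
    refine h.congr_deriv ?_
    rw [hT, Polynomial.derivative_monomial, Polynomial.aeval_monomial, ← Algebra.smul_def,
      trace_smul, trace_sum, smul_mul_assoc, trace_smul, mul_smul]
    congr 1
    have : ∀ i ∈ Finset.range m, (A t ^ (m.pred - i) * A' * A t ^ i).trace
        = (A t ^ (m - 1) * A').trace := fun i hi => by
      have hi' := Finset.mem_range.1 hi
      rw [Matrix.trace_mul_cycle, ← pow_add]
      congr 3
      rw [Nat.pred_eq_sub_one]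
      omega
    rw [Finset.sum_congr rfl this]
    simp

/-- First variation of `angleTrace` along a curve of unitary matrices. -/
theorem exists_hasDerivAt_angleTrace (hp : Even p) (hp2 : 2 ≤ p) {k : Polynomial ℝ}
    (hk : IsAnglePolynomial k) {η : ℝ → U n} {η' : Matrix (Fin n) (Fin n) ℂ} {t : ℝ}
    (hη : HasDerivAt (fun s => (η s : Matrix (Fin n) (Fin n) ℂ)) η' t) :
    ∃ D : ℝ, HasDerivAt (fun s => angleTrace p k (η s : Matrix (Fin n) (Fin n) ℂ)) D t ∧
      |D| ≤ p * (angleTrace p k (η t : Matrix (Fin n) (Fin n) ℂ)) ^ (1 - 1 / (p : ℝ)) *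
        schattenNorm p η' := by
  set v : Matrix (Fin n) (Fin n) ℂ := (η t : Matrix (Fin n) (Fin n) ℂ) with hv
  obtain ⟨Y, hY⟩ : ∃ Y : Matrix (Fin n) (Fin n) ℂ, Y = vᴴ * η' := ⟨_, rfl⟩
  have hvY : η' = v * Y := by
    rw [hY, ← Matrix.mul_assoc, hv, self_mul_conjTranspose_coe, Matrix.one_mul]
  -- Differentiating `ηᴴ η = 1` shows that `Y` is skew-Hermitian.
  have hskew : Yᴴ = -Y := by
    have h1 := hη.star.mul hη
    have h2 : (fun s => star (η s : Matrix (Fin n) (Fin n) ℂ)) *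
        (fun s => (η s : Matrix (Fin n) (Fin n) ℂ)) = fun _ => 1 :=
      funext fun s => conjTranspose_mul_self_coe (η s)
    rw [h2] at h1
    have h3 := h1.unique (hasDerivAt_const t 1)
    rw [star_eq_conjTranspose, star_eq_conjTranspose, ← hv] at h3
    rw [hY, conjTranspose_mul, conjTranspose_conjTranspose]
    exact eq_neg_of_add_eq_zero_left h3
  have hA : HasDerivAt (fun s => hermPart (η s : Matrix (Fin n) (Fin n) ℂ))
      ((2⁻¹ : ℂ) • (v * Y - Y * vᴴ)) t := by
    have h1 := (hη.add hη.star).const_smul (2⁻¹ : ℂ)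
    refine h1.congr_deriv ?_
    rw [star_eq_conjTranspose, hvY, conjTranspose_mul, hskew, Matrix.neg_mul, sub_eq_add_neg]
  have hder := hasDerivAt_trace_aeval hA (k ^ p)
  obtain ⟨V, φ, -, hφ⟩ := exists_conjDiag_of_unitary (η t)
  rw [← hv] at hφ
  set P' : Polynomial ℝ := Polynomial.derivative (k ^ p) with hP'
  set c : Fin n → ℂ := fun j =>
    ((k.eval (Real.cos (φ j)) ^ (p - 1) * k.derivative.eval (Real.cos (φ j)) * Real.sin (φ j) : ℝ)
      : ℂ) * Complex.I with hc
  have hherm : hermPart v = conjDiag V fun j => ((Real.cos (φ j) : ℝ) : ℂ) := by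
    rw [hφ, hermPart_conjDiag]
    simp only [Complex.exp_ofReal_mul_I_re]
  have htr : (Polynomial.aeval (hermPart v) P' * ((2⁻¹ : ℂ) • (v * Y - Y * vᴴ))).trace
      = p * (conjDiag V c * Y).trace := by
    have e1 : (Polynomial.aeval (hermPart v) P' * ((2⁻¹ : ℂ) • (v * Y - Y * vᴴ))).trace
        = (((2⁻¹ : ℂ) • (Polynomial.aeval (hermPart v) P' * v -
          vᴴ * Polynomial.aeval (hermPart v) P')) * Y).trace := by
      rw [Matrix.mul_smul, Matrix.smul_mul, trace_smul, trace_smul, Matrix.mul_sub, Matrix.sub_mul,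
        trace_sub, trace_sub, Matrix.mul_assoc _ v, ← Matrix.mul_assoc _ Y,
        Matrix.trace_mul_cycle _ Y]
    have e2 : (2⁻¹ : ℂ) • (Polynomial.aeval (hermPart v) P' * v -
          vᴴ * Polynomial.aeval (hermPart v) P') = (p : ℂ) • conjDiag V c := by
      rw [hherm, aeval_conjDiag, hφ, conjTranspose_conjDiag, ← map_mul, ← map_mul, ← map_sub,
        ← map_smul, ← map_smul]
      refine congrArg _ (funext fun j => ?_)
      simp only [Pi.smul_apply, Pi.sub_apply, Pi.mul_apply, Pi.star_apply, hc, hP',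
        Polynomial.derivative_pow, Polynomial.eval_mul, Polynomial.eval_pow, Polynomial.eval_C,
        RCLike.star_def, ← Complex.exp_conj, map_mul, Complex.conj_ofReal, Complex.conj_I,
        smul_eq_mul]
      rw [mul_neg, ← neg_mul, Complex.exp_mul_I, Complex.exp_mul_I, Complex.cos_neg,
        Complex.sin_neg]
      push_cast
      ring
    rw [e1, e2, Matrix.smul_mul, trace_smul, smul_eq_mul]
  rw [htr] at hder
  refine ⟨_, Complex.reCLM.hasFDerivAt.comp_hasDerivAt t hder, ?_⟩
  have hs : ∀ j, ‖c j‖ ≤ |k.eval (Real.cos (φ j))| ^ (p - 1) := fun j => by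
    simp only [hc]
    rw [norm_mul, Complex.norm_I, mul_one, Complex.norm_real, Real.norm_eq_abs, mul_assoc, abs_mul,
      abs_pow]
    exact mul_le_of_le_one_right (by positivity) (hk.2 _)
  have hH := norm_trace_conjDiag_mul_le hp hp2 V c _ (fun j => abs_nonneg _) hs Y
  have hval : angleTrace p k v = ∑ j, |k.eval (Real.cos (φ j))| ^ p := by
    rw [hφ, angleTrace_conjDiag]
    exact Finset.sum_congr rfl fun j _ => (hp.pow_abs _).symm
  have hnorm : schattenNorm p η' = schattenNorm p Y := by
    rw [hvY, hv, schattenNorm_unitary_mul]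
  rw [hval, hnorm, mul_assoc]
  calc |Complex.reCLM ((p : ℂ) * (conjDiag V c * Y).trace)|
      ≤ ‖(p : ℂ) * (conjDiag V c * Y).trace‖ := Complex.abs_re_le_norm _
    _ = p * ‖(conjDiag V c * Y).trace‖ := by rw [norm_mul, Complex.norm_natCast]
    _ ≤ _ := by gcongr

end

/-! ### The lower bound for lengths -/

section

open Matrix MeasureTheory Set

variable {n : ℕ} {p : ℕ}

theorem PiecewiseSmooth.exists_countable {γ : ℝ → U n} (hγ : PiecewiseSmooth γ) :
    ∃ s : Set ℝ, s.Countable ∧ ∀ t ∈ Ioo (0 : ℝ) 1 \ s, DifferentiableAt ℝ (toMatrixCurve γ) t := by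
  obtain ⟨-, m, τ, h0, h1, hτ⟩ := hγ
  refine ⟨range τ, countable_range τ, fun t ht => ?_⟩
  have hex : ∃ i, t < τ i := ⟨m, h1 ▸ ht.1.2⟩
  have hi : Nat.find hex ≠ 0 := fun h => by
    have := Nat.find_spec hex
    rw [h, h0] at this
    exact lt_asymm this ht.1.1
  obtain ⟨i, hi⟩ := Nat.exists_eq_succ_of_ne_zero hi
  have hlt : t < τ (i + 1) := by
    have := Nat.find_spec hex
    rwa [hi] at this
  have hge : τ i ≤ t := not_lt.1 (Nat.find_min hex (by omega))
  have hne : τ i ≠ t := fun h => ht.2 ⟨i, h⟩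
  have him : i < m := by
    have := Nat.find_min' hex (h1 ▸ ht.1.2 : t < τ m)
    omega
  exact ((hτ i him).2.differentiableOn (by simp)).differentiableAt
    (Icc_mem_nhds (lt_of_le_of_ne hge hne) hlt)

theorem PiecewiseSmooth.intervalIntegrable (hp2 : 2 ≤ p) {γ : ℝ → U n} (hγ : PiecewiseSmooth γ) :
    IntervalIntegrable (fun t => schattenNorm p (deriv (toMatrixCurve γ) t)) volume 0 1 := by
  obtain ⟨-, m, τ, h0, h1, hτ⟩ := hγ
  rw [← h0, ← h1]
  refine IntervalIntegrable.trans_iterate fun i hi => ?_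
  obtain ⟨hlt, hs⟩ := hτ i hi
  rw [intervalIntegrable_iff_integrableOn_Ioo_of_le hlt.le]
  have hc : ContinuousOn (fun t => schattenNorm p
      (derivWithin (toMatrixCurve γ) (Icc (τ i) (τ (i + 1))) t)) (Icc (τ i) (τ (i + 1))) :=
    (continuous_schattenNorm hp2).comp_continuousOn
      (hs.continuousOn_derivWithin (uniqueDiffOn_Icc hlt) (by simp))
  refine (hc.integrableOn_Icc.mono_set Ioo_subset_Icc_self).congr_fun (fun t ht => ?_)
    measurableSet_Ioo
  simp only [derivWithin_of_mem_nhds (Icc_mem_nhds ht.1 ht.2)]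

/-- The `p`-th root of `angleTrace` grows along a curve by at most the length of the curve. -/
theorem angleTrace_rpow_le_integral (hp : Even p) (hp2 : 2 ≤ p) {k : Polynomial ℝ}
    (hk : IsAnglePolynomial k) {γ : ℝ → U n} (hγ : PiecewiseSmooth γ) {a b : ℝ} (ha : 0 ≤ a)
    (hab : a ≤ b) (hb : b ≤ 1) :
    angleTrace p k ((star (γ a) * γ b : U n) : Matrix (Fin n) (Fin n) ℂ) ^ (1 / (p : ℝ))
      ≤ ∫ t in a..b, schattenNorm p (deriv (toMatrixCurve γ) t) := by
  have hp0 : (0 : ℝ) < p := by positivity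
  set η : ℝ → U n := fun s => star (γ a) * γ s with hηdef
  set F : ℝ → ℝ := fun s => angleTrace p k (η s : Matrix (Fin n) (Fin n) ℂ) with hF
  have hF0 : ∀ s, 0 ≤ F s := fun s => angleTrace_nonneg hp k _
  have hFa : F a = 0 := by
    have h1 : ((η a : U n) : Matrix (Fin n) (Fin n) ℂ)
        = conjDiag 1 fun j => Complex.exp (((0 : Fin n → ℝ) j : ℝ) * Complex.I) := by
      simp only [hηdef, Unitary.star_mul_self, Pi.zero_apply, Complex.ofReal_zero, zero_mul,
        Complex.exp_zero]
      exact (map_one (conjDiag 1)).symm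
    simp only [hF]
    rw [h1, angleTrace_conjDiag]
    simp [hk.1, show p ≠ 0 by omega]
  have hsub : Icc a b ⊆ Icc (0 : ℝ) 1 := Icc_subset_Icc ha hb
  have hFc : ContinuousOn F (Icc a b) := by
    refine (continuous_angleTrace k).comp_continuousOn ?_
    exact continuousOn_const.mul (hγ.1.mono hsub)
  obtain ⟨s, hs, hdiff⟩ := hγ.exists_countable
  have hint : IntervalIntegrable (fun t => schattenNorm p (deriv (toMatrixCurve γ) t))
      volume a b := (hγ.intervalIntegrable hp2).mono_set <| by
    rw [uIcc_of_le hab, uIcc_of_le zero_le_one]; exact hsub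
  refine le_of_forall_pos_le_add fun δ hδ => ?_
  -- Adding `δ ^ p` keeps the `p`-th root differentiable where `F` vanishes.
  set Ψ : ℝ → ℝ := fun t => (F t + δ ^ p) ^ (1 / (p : ℝ)) with hΨ
  have hδp : 0 < δ ^ p := by positivity
  have hder : ∀ t ∈ Ioo a b \ s, DifferentiableAt ℝ Ψ t ∧
      |deriv Ψ t| ≤ schattenNorm p (deriv (toMatrixCurve γ) t) := fun t ht => by
    have h1 := (hdiff t ⟨⟨ha.trans_lt ht.1.1, ht.1.2.trans_le hb⟩, ht.2⟩).hasDerivAt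
    have h2 : HasDerivAt (fun r => (η r : Matrix (Fin n) (Fin n) ℂ))
        (((star (γ a) : U n) : Matrix (Fin n) (Fin n) ℂ) * deriv (toMatrixCurve γ) t) t :=
      h1.const_mul _
    obtain ⟨D, hD, hDle⟩ := exists_hasDerivAt_angleTrace hp hp2 hk h2
    rw [schattenNorm_unitary_mul] at hDle
    have hpos : 0 < F t + δ ^ p := add_pos_of_nonneg_of_pos (hF0 t) hδp
    have h3 : HasDerivAt Ψ (D * (1 / (p : ℝ)) * (F t + δ ^ p) ^ (1 / (p : ℝ) - 1)) t :=
      (hD.add_const (δ ^ p)).rpow_const (Or.inl hpos.ne')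
    refine ⟨h3.differentiableAt, ?_⟩
    have h4 : F t ^ (1 - 1 / (p : ℝ)) ≤ (F t + δ ^ p) ^ (1 - 1 / (p : ℝ)) := by
      refine Real.rpow_le_rpow (hF0 t) (by linarith) ?_
      rw [sub_nonneg, div_le_one hp0]
      exact_mod_cast (by omega : 1 ≤ p)
    have h5 : (F t + δ ^ p) ^ (1 - 1 / (p : ℝ)) * (F t + δ ^ p) ^ (1 / (p : ℝ) - 1) = 1 := by
      rw [← Real.rpow_add hpos]
      simp
    have h6 : 0 < (F t + δ ^ p) ^ (1 / (p : ℝ) - 1) := Real.rpow_pos_of_pos hpos _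
    have hS : 0 ≤ schattenNorm p (deriv (toMatrixCurve γ) t) := schattenNorm_nonneg _
    rw [h3.deriv, abs_mul, abs_mul, abs_of_pos h6, abs_of_pos (one_div_pos.2 hp0)]
    calc |D| * (1 / (p : ℝ)) * (F t + δ ^ p) ^ (1 / (p : ℝ) - 1)
        ≤ (p * (F t + δ ^ p) ^ (1 - 1 / (p : ℝ)) * schattenNorm p (deriv (toMatrixCurve γ) t)) *
          (1 / (p : ℝ)) * (F t + δ ^ p) ^ (1 / (p : ℝ) - 1) := by
          gcongr
          exact hDle.trans (by gcongr)
      _ = (p * (1 / (p : ℝ))) * ((F t + δ ^ p) ^ (1 - 1 / (p : ℝ)) *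
          (F t + δ ^ p) ^ (1 / (p : ℝ) - 1)) * schattenNorm p (deriv (toMatrixCurve γ) t) := by
          ring
      _ = _ := by rw [h5, mul_one_div_cancel hp0.ne', one_mul, one_mul]
  have hae : ∀ᵐ t ∂volume.restrict (Ioc a b), t ∈ Ioo a b \ s := by
    rw [← Measure.restrict_congr_set Ioo_ae_eq_Ioc]
    filter_upwards [ae_restrict_mem measurableSet_Ioo,
      ae_restrict_of_ae (measure_eq_zero_iff_ae_notMem.1 (hs.measure_zero volume))] with t h1 h2
    exact ⟨h1, h2⟩
  have hΨint : IntervalIntegrable (deriv Ψ) volume a b := by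
    rw [intervalIntegrable_iff_integrableOn_Ioc_of_le hab] at hint ⊢
    refine Integrable.mono' hint (aestronglyMeasurable_deriv Ψ _) ?_
    filter_upwards [hae] with t ht
    exact (hder t ht).2
  have hΨc : ContinuousOn Ψ (Icc a b) :=
    (hFc.add continuousOn_const).rpow_const fun t _ => Or.inr (by positivity)
  have hftc := integral_eq_of_hasDerivAt_off_countable_of_le Ψ (deriv Ψ) hab hs hΨc
    (fun t ht => (hder t ht).1.hasDerivAt) hΨint
  have hmono : ∫ t in a..b, deriv Ψ t
      ≤ ∫ t in a..b, schattenNorm p (deriv (toMatrixCurve γ) t) := by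
    rw [intervalIntegral.integral_of_le hab, intervalIntegral.integral_of_le hab]
    rw [intervalIntegrable_iff_integrableOn_Ioc_of_le hab] at hint hΨint
    refine integral_mono_ae hΨint hint ?_
    filter_upwards [hae] with t ht
    exact (le_abs_self _).trans (hder t ht).2
  have hΨa : Ψ a = δ := by
    simp only [hΨ, hFa, zero_add, one_div]
    exact Real.pow_rpow_inv_natCast hδ.le (by omega)
  have hΨb : F b ^ (1 / (p : ℝ)) ≤ Ψ b :=
    Real.rpow_le_rpow (hF0 b) (by linarith) (by positivity)
  change F b ^ (1 / (p : ℝ)) ≤ _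
  linarith

end

/-! ### One-parameter curves are geodesics -/

section

open Matrix MeasureTheory Set Filter Topology

variable {n : ℕ} {p : ℕ}

/-- The unitary `W diag(exp (i θ)) Wᴴ`. -/
noncomputable def conjExp (W : U n) (θ : Fin n → ℝ) : U n :=
  ⟨conjDiag W fun j => Complex.exp (θ j * Complex.I), by
    have h : ∀ j, Complex.exp (θ j * Complex.I) * star (Complex.exp (θ j * Complex.I)) = 1 :=
      fun j => by
        rw [RCLike.star_def, Complex.mul_conj, Complex.normSq_eq_norm_sq,
          Complex.norm_exp_ofReal_mul_I]
        norm_num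
    rw [mem_unitaryGroup_iff, star_eq_conjTranspose, conjTranspose_conjDiag, ← map_mul,
      ← map_one (conjDiag W)]
    exact congrArg _ (funext h)⟩

theorem coe_conjExp (W : U n) (θ : Fin n → ℝ) : (conjExp W θ : Matrix (Fin n) (Fin n) ℂ)
    = conjDiag W fun j => Complex.exp (θ j * Complex.I) := rfl

theorem conjExp_zero (W : U n) : conjExp W 0 = 1 := by
  apply Subtype.ext
  rw [coe_conjExp]
  simp only [Pi.zero_apply, Complex.ofReal_zero, zero_mul, Complex.exp_zero]
  exact map_one (conjDiag W)

theorem conjExp_add (W : U n) (θ φ : Fin n → ℝ) :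
    conjExp W (θ + φ) = conjExp W θ * conjExp W φ := by
  apply Subtype.ext
  rw [Submonoid.coe_mul, coe_conjExp, coe_conjExp, coe_conjExp, ← map_mul]
  refine congrArg _ (funext fun j => ?_)
  rw [Pi.mul_apply, ← Complex.exp_add, Pi.add_apply, Complex.ofReal_add, add_mul]

theorem exists_eq_conjExp (v : U n) :
    ∃ (W : U n) (θ : Fin n → ℝ), (∀ j, |θ j| ≤ Real.pi) ∧ v = conjExp W θ := by
  obtain ⟨W, θ, hθ, h⟩ := exists_conjDiag_of_unitary v
  exact ⟨W, θ, hθ, Subtype.ext h⟩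

/-- The curve `t ↦ u W diag(exp (i t θ)) Wᴴ`, a translate of a one-parameter group. -/
noncomputable def expCurve (u W : U n) (θ : Fin n → ℝ) (t : ℝ) : U n := u * conjExp W (t • θ)

theorem toMatrixCurve_expCurve (u W : U n) (θ : Fin n → ℝ) :
    toMatrixCurve (expCurve u W θ) = fun t => (u : Matrix (Fin n) (Fin n) ℂ) *
      conjDiag W fun j => Complex.exp ((t * θ j : ℝ) * Complex.I) := rfl

/-- `conjDiag` as a continuous linear map over the reals. -/
noncomputable def conjDiagL (W : U n) : (Fin n → ℂ) →L[ℝ] Matrix (Fin n) (Fin n) ℂ :=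
  LinearMap.toContinuousLinearMap ((conjDiag W).toLinearMap.restrictScalars ℝ)

theorem conjDiagL_apply (W : U n) (d : Fin n → ℂ) : conjDiagL W d = conjDiag W d := rfl

theorem contDiff_expCurve (u W : U n) (θ : Fin n → ℝ) :
    ContDiff ℝ ∞ (toMatrixCurve (expCurve u W θ)) := by
  rw [toMatrixCurve_expCurve]
  refine contDiff_const.mul ((conjDiagL W).contDiff.comp (contDiff_pi.2 fun j => ?_))
  refine ContDiff.cexp (ContDiff.mul ?_ contDiff_const)
  exact Complex.ofRealCLM.contDiff.comp (contDiff_id.mul contDiff_const)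

theorem hasDerivAt_expCurve (u W : U n) (θ : Fin n → ℝ) (t : ℝ) :
    HasDerivAt (toMatrixCurve (expCurve u W θ)) ((expCurve u W θ t : Matrix (Fin n) (Fin n) ℂ) *
      conjDiag W fun j => (θ j : ℂ) * Complex.I) t := by
  rw [toMatrixCurve_expCurve]
  have h1 : HasDerivAt (fun t : ℝ => fun j : Fin n => Complex.exp ((t * θ j : ℝ) * Complex.I))
      (fun j => Complex.exp ((t * θ j : ℝ) * Complex.I) * (θ j * Complex.I)) t := by
    refine hasDerivAt_pi.2 fun j => ?_
    have h := (((hasDerivAt_id t).mul_const (θ j)).ofReal_comp.mul_const Complex.I).cexp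
    simpa using h
  have h2 := ((conjDiagL W).hasFDerivAt.comp_hasDerivAt t h1).const_mul
    (u : Matrix (Fin n) (Fin n) ℂ)
  refine h2.congr_deriv ?_
  rw [conjDiagL_apply, expCurve, Submonoid.coe_mul, coe_conjExp, Matrix.mul_assoc, ← map_mul]
  rfl

theorem joins_expCurve (u W : U n) (θ : Fin n → ℝ) :
    Joins (expCurve u W θ) u (u * conjExp W θ) where
  piecewiseSmooth := ⟨(contDiff_expCurve u W θ).continuous.continuousOn, 1, fun i => i, by simp,
    by simp, fun i _ => ⟨by simp, (contDiff_expCurve u W θ).contDiffOn⟩⟩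
  source := by rw [expCurve, zero_smul, conjExp_zero, mul_one]
  target := by rw [expCurve, one_smul]

theorem curveLength_expCurve (hp : Even p) (u W : U n) (θ : Fin n → ℝ) :
    curveLength p (expCurve u W θ) = (∑ j, |θ j| ^ p) ^ (1 / (p : ℝ)) := by
  have h : ∀ t, schattenNorm p (deriv (toMatrixCurve (expCurve u W θ)) t)
      = (∑ j, |θ j| ^ p) ^ (1 / (p : ℝ)) := fun t => by
    rw [(hasDerivAt_expCurve u W θ t).deriv, schattenNorm_unitary_mul, schattenNorm_conjDiag hp]
    simp
  simp [curveLength, h]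

theorem tendsto_angleTrace_rpow {k : ℕ → Polynomial ℝ}
    (hk : ∀ x ∈ Icc (-1 : ℝ) 1, Tendsto (fun N => (k N).eval x) atTop (𝓝 (Real.arccos x)))
    (W : U n) {θ : Fin n → ℝ} (hθ : ∀ j, |θ j| ≤ Real.pi) :
    Tendsto (fun N => angleTrace p (k N) (conjExp W θ : Matrix (Fin n) (Fin n) ℂ) ^ (1 / (p : ℝ)))
      atTop (𝓝 ((∑ j, |θ j| ^ p) ^ (1 / (p : ℝ)))) := by
  simp only [coe_conjExp, angleTrace_conjDiag]
  have h : Tendsto (fun N => ∑ j, (k N).eval (Real.cos (θ j)) ^ p) atTop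
      (𝓝 (∑ j, |θ j| ^ p)) := by
    refine tendsto_finsetSum _ fun j _ => ?_
    have := (hk (Real.cos (θ j)) ⟨Real.neg_one_le_cos _, Real.cos_le_one _⟩).pow p
    rwa [← Real.cos_abs, Real.arccos_cos (abs_nonneg _) (hθ j), Real.cos_abs] at this
  exact h.rpow_const (Or.inr (by positivity))

/-- The length of a curve between two points is at least the `ℓ^p` norm of the principal
arguments of the eigenvalues of their quotient. -/
theorem sum_abs_rpow_le_integral (hp : Even p) (hp2 : 2 ≤ p) {γ : ℝ → U n}
    (hγ : PiecewiseSmooth γ) {a b : ℝ} (ha : 0 ≤ a) (hab : a ≤ b) (hb : b ≤ 1) {W : U n}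
    {θ : Fin n → ℝ} (hθ : ∀ j, |θ j| ≤ Real.pi) (h : γ b = γ a * conjExp W θ) :
    (∑ j, |θ j| ^ p) ^ (1 / (p : ℝ))
      ≤ ∫ t in a..b, schattenNorm p (deriv (toMatrixCurve γ) t) := by
  obtain ⟨k, hk, hlim⟩ := exists_seq_isAnglePolynomial
  refine le_of_tendsto (tendsto_angleTrace_rpow hlim W hθ) (Eventually.of_forall fun N => ?_)
  have := angleTrace_rpow_le_integral hp hp2 (hk N) hγ ha hab hb
  rwa [h, ← mul_assoc, Unitary.star_mul_self, one_mul] at this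

theorem sum_abs_rpow_le_curveLength (hp : Even p) (hp2 : 2 ≤ p) {γ : ℝ → U n} {u W : U n}
    {θ : Fin n → ℝ} (hθ : ∀ j, |θ j| ≤ Real.pi) (h : Joins γ u (u * conjExp W θ)) :
    (∑ j, |θ j| ^ p) ^ (1 / (p : ℝ)) ≤ curveLength p γ :=
  sum_abs_rpow_le_integral hp hp2 h.piecewiseSmooth le_rfl zero_le_one le_rfl hθ
    (by rw [h.source, h.target])

/-- The distance in closed form: the principal arguments of the eigenvalues of the quotient of the
two points, in `ℓ^p` norm. -/
theorem rectDist_mul_conjExp (hp : Even p) (hp2 : 2 ≤ p) (u W : U n) {θ : Fin n → ℝ}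
    (hθ : ∀ j, |θ j| ≤ Real.pi) :
    rectDist p u (u * conjExp W θ) = (∑ j, |θ j| ^ p) ^ (1 / (p : ℝ)) := by
  refine IsLeast.csInf_eq ⟨⟨_, joins_expCurve u W θ, curveLength_expCurve hp u W θ⟩, ?_⟩
  rintro L ⟨γ, hγ, rfl⟩
  exact sum_abs_rpow_le_curveLength hp hp2 hθ hγ

theorem isGeodesic_expCurve (hp : Even p) (hp2 : 2 ≤ p) (u W : U n) {θ : Fin n → ℝ}
    (hθ : ∀ j, |θ j| ≤ Real.pi) : IsGeodesic p (expCurve u W θ) u (u * conjExp W θ) where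
  joins := joins_expCurve u W θ
  minimal := by rw [curveLength_expCurve hp, rectDist_mul_conjExp hp hp2 u W hθ]

/-- Closed balls are cut out by the continuous functions `angleTrace`. -/
theorem isClosed_preimage_closedBall (hp : Even p) (hp2 : 2 ≤ p) (u : U n) (R : ℝ)
    {δ : ℝ → U n} (hδ : Continuous (toMatrixCurve δ)) : IsClosed {t | rectDist p u (δ t) ≤ R} := by
  obtain ⟨k, hk, hlim⟩ := exists_seq_isAnglePolynomial
  have h : {t | rectDist p u (δ t) ≤ R} = ⋂ N, {t | angleTrace p (k N)
      ((star u * δ t : U n) : Matrix (Fin n) (Fin n) ℂ) ^ (1 / (p : ℝ)) ≤ R} := by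
    ext t
    obtain ⟨W, θ, hθ, h⟩ := exists_eq_conjExp (star u * δ t)
    have hv : δ t = u * conjExp W θ := by rw [← h, ← mul_assoc, Unitary.mul_star_self, one_mul]
    simp only [mem_ofPred_eq, mem_iInter]
    rw [h, hv, rectDist_mul_conjExp hp hp2 u W hθ]
    refine ⟨fun hR N => le_trans ?_ hR, fun hR => le_of_tendsto' (tendsto_angleTrace_rpow hlim
      W hθ) hR⟩
    have hJ := joins_expCurve u W θ
    have := angleTrace_rpow_le_integral hp hp2 (hk N) hJ.piecewiseSmooth le_rfl zero_le_one le_rfl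
    rw [hJ.source, hJ.target, ← mul_assoc, Unitary.star_mul_self, one_mul] at this
    rw [← curveLength_expCurve hp u W θ]
    exact this
  rw [h]
  refine isClosed_iInter fun N => isClosed_le ?_ continuous_const
  refine Continuous.rpow_const ?_ fun _ => Or.inr (by positivity)
  exact (continuous_angleTrace (k N)).comp (continuous_const.mul hδ)

end

/-! ### Convexity of balls -/

section

open Matrix MeasureTheory Set Filter Topology

variable {n : ℕ} {p : ℕ}

theorem re_conj_hermPart_diag (V : U n) (A : Matrix (Fin n) (Fin n) ℂ) (j : Fin n) :
    (((V : Matrix (Fin n) (Fin n) ℂ)ᴴ * hermPart A * (V : Matrix (Fin n) (Fin n) ℂ)) j j).re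
      = (((V : Matrix (Fin n) (Fin n) ℂ)ᴴ * A * (V : Matrix (Fin n) (Fin n) ℂ)) j j).re := by
  set X := (V : Matrix (Fin n) (Fin n) ℂ)ᴴ * A * (V : Matrix (Fin n) (Fin n) ℂ) with hX
  have h : (V : Matrix (Fin n) (Fin n) ℂ)ᴴ * hermPart A * (V : Matrix (Fin n) (Fin n) ℂ)
      = (2⁻¹ : ℂ) • (X + Xᴴ) := by
    rw [hermPart, hX, conjTranspose_mul, conjTranspose_mul, conjTranspose_conjTranspose,
      Matrix.mul_smul, Matrix.smul_mul, Matrix.mul_add, Matrix.add_mul, Matrix.mul_assoc _ Aᴴ]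
  rw [h, Matrix.smul_apply, Matrix.add_apply, conjTranspose_apply, RCLike.star_def,
    Complex.add_conj]
  simp

theorem abs_le_of_sum_rpow_le (hp2 : 2 ≤ p) {θ : Fin n → ℝ} {R : ℝ}
    (h : (∑ j, |θ j| ^ p) ^ (1 / (p : ℝ)) ≤ R) (j : Fin n) : |θ j| ≤ R := by
  refine le_trans ?_ h
  rw [one_div]
  calc |θ j| = (|θ j| ^ p) ^ ((p : ℝ)⁻¹) :=
        (Real.pow_rpow_inv_natCast (abs_nonneg _) (by omega)).symm
    _ ≤ _ := by
        refine Real.rpow_le_rpow (by positivity) ?_ (by positivity)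
        exact Finset.single_le_sum (f := fun j => |θ j| ^ p) (fun _ _ => by positivity)
          (Finset.mem_univ j)

/-- If two unitaries `v = m exp (-i y)` and `w = m exp (i y)` have eigenvalues of principal
arguments at most `R < π / 2`, then the trace of the `p`-th power of the argument is midpoint
convex. -/
theorem sum_abs_pow_midpoint_le (hp : Even p) {R : ℝ} (hR : R < Real.pi / 2)
    {V W₁ W₂ T : U n} {φ α β y : Fin n → ℝ} (hφ : ∀ j, |φ j| ≤ Real.pi)
    (hα : ∀ j, |α j| ≤ R) (hβ : ∀ j, |β j| ≤ R) (hy : ∀ j, 0 ≤ Real.cos (y j))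
    (h₁ : conjExp V φ * conjExp T (-y) = conjExp W₁ α)
    (h₂ : conjExp V φ * conjExp T y = conjExp W₂ β) :
    2 * ∑ j, |φ j| ^ p ≤ ∑ j, |α j| ^ p + ∑ j, |β j| ^ p := by
  have hcos : ∀ x : ℝ, |x| ≤ R → Real.cos x ∈ Ioc 0 1 := fun x hx =>
    ⟨Real.cos_pos_of_mem_Ioo ⟨by linarith [neg_abs_le x], by linarith [le_abs_self x]⟩,
      Real.cos_le_one x⟩
  have harc : ∀ x : ℝ, |x| ≤ Real.pi → |x| ^ p = Real.arccos (Real.cos x) ^ p := fun x hx => by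
    rw [← Real.cos_abs, Real.arccos_cos (abs_nonneg _) hx]
  have hconv := convexOn_arccos_pow hp
  have hIoc : Ioc (0 : ℝ) 1 ⊆ Icc (-1) 1 := fun x hx => ⟨by linarith [hx.1], hx.2⟩
  -- `a`, `b` and `c` are the diagonals of `Re v`, `Re w` and `cos y` in the eigenbasis of `m`.
  set a : Fin n → ℝ := fun j => (((V : Matrix (Fin n) (Fin n) ℂ)ᴴ *
    conjDiag W₁ (fun j => ((Real.cos (α j) : ℝ) : ℂ)) * (V : Matrix (Fin n) (Fin n) ℂ)) j j).re
    with ha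
  set b : Fin n → ℝ := fun j => (((V : Matrix (Fin n) (Fin n) ℂ)ᴴ *
    conjDiag W₂ (fun j => ((Real.cos (β j) : ℝ) : ℂ)) * (V : Matrix (Fin n) (Fin n) ℂ)) j j).re
    with hb
  set c : Fin n → ℝ := fun j => (((V : Matrix (Fin n) (Fin n) ℂ)ᴴ *
    conjDiag T (fun j => ((Real.cos (y j) : ℝ) : ℂ)) * (V : Matrix (Fin n) (Fin n) ℂ)) j j).re
    with hc
  have ha_mem : ∀ j, a j ∈ Ioc (0 : ℝ) 1 :=
    conj_conjDiag_diag_mem V W₁ _ (convex_Ioc 0 1) fun j => hcos _ (hα j)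
  have hb_mem : ∀ j, b j ∈ Ioc (0 : ℝ) 1 :=
    conj_conjDiag_diag_mem V W₂ _ (convex_Ioc 0 1) fun j => hcos _ (hβ j)
  have hc_mem : ∀ j, c j ∈ Icc (0 : ℝ) 1 :=
    conj_conjDiag_diag_mem V T _ (convex_Icc 0 1) fun j => ⟨hy j, Real.cos_le_one _⟩
  have key : ∀ j, a j + b j = 2 * (Real.cos (φ j) * c j) := fun j => by
    have ea : a j = (((V : Matrix (Fin n) (Fin n) ℂ)ᴴ * (conjExp W₁ α : Matrix (Fin n) (Fin n) ℂ) *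
        (V : Matrix (Fin n) (Fin n) ℂ)) j j).re := by
      rw [← re_conj_hermPart_diag, coe_conjExp, hermPart_conjDiag]
      simp only [Complex.exp_ofReal_mul_I_re, ha]
    have eb : b j = (((V : Matrix (Fin n) (Fin n) ℂ)ᴴ * (conjExp W₂ β : Matrix (Fin n) (Fin n) ℂ) *
        (V : Matrix (Fin n) (Fin n) ℂ)) j j).re := by
      rw [← re_conj_hermPart_diag, coe_conjExp, hermPart_conjDiag]
      simp only [Complex.exp_ofReal_mul_I_re, hb]
    have esum : (conjExp W₁ α : Matrix (Fin n) (Fin n) ℂ) +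
          (conjExp W₂ β : Matrix (Fin n) (Fin n) ℂ)
        = (2 : ℂ) • ((conjExp V φ : Matrix (Fin n) (Fin n) ℂ) *
          conjDiag T (fun j => ((Real.cos (y j) : ℝ) : ℂ))) := by
      rw [← h₁, ← h₂, Submonoid.coe_mul, Submonoid.coe_mul, ← Matrix.mul_add, ← Matrix.mul_smul,
        coe_conjExp T, coe_conjExp T, ← map_add, ← map_smul]
      refine congrArg _ (congrArg _ (funext fun j => ?_))
      simp only [Pi.add_apply, Pi.neg_apply, Pi.smul_apply, smul_eq_mul, Complex.exp_mul_I]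
      push_cast
      rw [Complex.cos_neg, Complex.sin_neg]
      ring
    have econj : (V : Matrix (Fin n) (Fin n) ℂ)ᴴ * ((conjExp V φ : Matrix (Fin n) (Fin n) ℂ) *
          conjDiag T (fun j => ((Real.cos (y j) : ℝ) : ℂ))) * (V : Matrix (Fin n) (Fin n) ℂ)
        = diagonal (fun j => Complex.exp (φ j * Complex.I)) *
          ((V : Matrix (Fin n) (Fin n) ℂ)ᴴ * conjDiag T (fun j => ((Real.cos (y j) : ℝ) : ℂ)) *
            (V : Matrix (Fin n) (Fin n) ℂ)) := by
      rw [← conj_conjDiag_self V, ← coe_conjExp]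
      calc _ = (V : Matrix (Fin n) (Fin n) ℂ)ᴴ * (conjExp V φ : Matrix (Fin n) (Fin n) ℂ) * 1 *
            conjDiag T (fun j => ((Real.cos (y j) : ℝ) : ℂ)) * (V : Matrix (Fin n) (Fin n) ℂ) := by
            simp only [Matrix.mul_assoc, Matrix.one_mul]
        _ = _ := by
            rw [← self_mul_conjTranspose_coe V]
            simp only [Matrix.mul_assoc]
    rw [ea, eb, ← Complex.add_re, ← Matrix.add_apply, ← Matrix.add_mul, ← Matrix.mul_add, esum,
      Matrix.mul_smul, Matrix.smul_mul, Matrix.smul_apply, econj, Matrix.diagonal_mul]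
    simp only [hc]
    rw [conj_conjDiag_diag, Complex.ofReal_re, smul_eq_mul, ← Complex.ofReal_ofNat,
      Complex.re_ofReal_mul, Complex.re_mul_ofReal, Complex.exp_ofReal_mul_I_re]
  have hle : ∀ j, 2 * |φ j| ^ p ≤ Real.arccos (a j) ^ p + Real.arccos (b j) ^ p := fun j => by
    have hk := key j
    have hφ0 : 0 ≤ Real.cos (φ j) := by
      by_contra hneg
      have := mul_nonpos_of_nonpos_of_nonneg (not_le.1 hneg).le (hc_mem j).1
      linarith [(ha_mem j).1, (hb_mem j).1]
    have hmid : 2⁻¹ * a j + 2⁻¹ * b j ≤ Real.cos (φ j) := by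
      have := mul_le_of_le_one_right hφ0 (hc_mem j).2
      linarith
    have h1 := hconv.2 (hIoc (ha_mem j)) (hIoc (hb_mem j)) (by norm_num : (0 : ℝ) ≤ 2⁻¹)
      (by norm_num : (0 : ℝ) ≤ 2⁻¹) (by norm_num)
    simp only [smul_eq_mul] at h1
    have h2 : Real.arccos (Real.cos (φ j)) ^ p ≤ Real.arccos (2⁻¹ * a j + 2⁻¹ * b j) ^ p :=
      pow_le_pow_left₀ (Real.arccos_nonneg _) (Real.antitone_arccos hmid) p
    rw [harc _ (hφ j)]
    linarith
  have hpi : R ≤ Real.pi := by linarith [Real.pi_pos]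
  have hPa := sum_convex_diag_le V W₁ (fun j => Real.cos (α j)) hconv fun j => hIoc (hcos _ (hα j))
  have hPb := sum_convex_diag_le V W₂ (fun j => Real.cos (β j)) hconv fun j => hIoc (hcos _ (hβ j))
  calc 2 * ∑ j, |φ j| ^ p ≤ ∑ j, (Real.arccos (a j) ^ p + Real.arccos (b j) ^ p) := by
        rw [Finset.mul_sum]
        exact Finset.sum_le_sum fun j _ => hle j
    _ = ∑ j, Real.arccos (a j) ^ p + ∑ j, Real.arccos (b j) ^ p := Finset.sum_add_distrib
    _ ≤ ∑ j, Real.arccos (Real.cos (α j)) ^ p + ∑ j, Real.arccos (Real.cos (β j)) ^ p :=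
        add_le_add hPa hPb
    _ = _ := by
        congr 1
        · exact Finset.sum_congr rfl fun j _ => (harc _ ((hα j).trans hpi)).symm
        · exact Finset.sum_congr rfl fun j _ => (harc _ ((hβ j).trans hpi)).symm

theorem rectDist_midpoint_le (hp : Even p) (hp2 : 2 ≤ p) {R : ℝ} (hR : R < Real.pi / 2)
    (u m T : U n) {y : Fin n → ℝ} (hy : ∀ j, 0 ≤ Real.cos (y j))
    (h₁ : rectDist p u (m * conjExp T (-y)) ≤ R) (h₂ : rectDist p u (m * conjExp T y) ≤ R) :
    rectDist p u m ≤ R := by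
  have hu : ∀ v : U n, ∃ (W : U n) (θ : Fin n → ℝ), (∀ j, |θ j| ≤ Real.pi) ∧
      v = u * conjExp W θ := fun v => by
    obtain ⟨W, θ, hθ, h⟩ := exists_eq_conjExp (star u * v)
    exact ⟨W, θ, hθ, by rw [← h, ← mul_assoc, Unitary.mul_star_self, one_mul]⟩
  obtain ⟨V, φ, hφ, rfl⟩ := hu m
  obtain ⟨W₁, α, hα, e₁⟩ := hu (u * conjExp V φ * conjExp T (-y))
  obtain ⟨W₂, β, hβ, e₂⟩ := hu (u * conjExp V φ * conjExp T y)
  rw [e₁, rectDist_mul_conjExp hp hp2 u W₁ hα] at h₁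
  rw [e₂, rectDist_mul_conjExp hp hp2 u W₂ hβ] at h₂
  rw [rectDist_mul_conjExp hp hp2 u V hφ]
  rw [mul_assoc] at e₁ e₂
  have hmid := sum_abs_pow_midpoint_le hp hR hφ (abs_le_of_sum_rpow_le hp2 h₁)
    (abs_le_of_sum_rpow_le hp2 h₂) hy (mul_left_cancel e₁) (mul_left_cancel e₂)
  have h0 : 0 ≤ ∑ j, |φ j| ^ p := Finset.sum_nonneg fun j _ => by positivity
  rcases le_total (∑ j, |α j| ^ p) (∑ j, |β j| ^ p) with h | h
  · exact (Real.rpow_le_rpow h0 (by linarith) (by positivity)).trans h₂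
  · exact (Real.rpow_le_rpow h0 (by linarith) (by positivity)).trans h₁

/-- A closed subset of `[0, 1]` that contains the endpoints and midpoints is everything. -/
theorem Icc_subset_of_isClosed_of_midpoint_mem {S : Set ℝ} (hS : IsClosed S) (h0 : 0 ∈ S)
    (h1 : 1 ∈ S) (hmid : ∀ x ∈ S ∩ Icc 0 1, ∀ y ∈ S ∩ Icc 0 1, (x + y) / 2 ∈ S) :
    Icc 0 1 ⊆ S := by
  intro t ht
  by_contra htS
  have hA : IsCompact (S ∩ Icc 0 t) := isCompact_Icc.inter_left hS
  have hB : IsCompact (S ∩ Icc t 1) := isCompact_Icc.inter_left hS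
  -- The component of `t` in the complement of `S` is an interval whose midpoint is in `S`.
  obtain ⟨a, ⟨haS, ha⟩, hamax⟩ := hA.exists_isGreatest ⟨0, h0, le_rfl, ht.1⟩
  obtain ⟨b, ⟨hbS, hb⟩, hbmin⟩ := hB.exists_isLeast ⟨1, h1, ht.2, le_rfl⟩
  have hat : a < t := lt_of_le_of_ne ha.2 fun h => htS (h ▸ haS)
  have htb : t < b := lt_of_le_of_ne hb.1 fun h => htS (h ▸ hbS)
  have hm := hmid a ⟨haS, ha.1, ha.2.trans ht.2⟩ b ⟨hbS, ht.1.trans hb.1, hb.2⟩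
  rcases le_total ((a + b) / 2) t with h | h
  · have := hamax ⟨hm, by linarith [ha.1, hb.1, ht.1], h⟩
    linarith
  · have := hbmin ⟨hm, h, by linarith [hb.2, ha.2, ht.2]⟩
    linarith

/-- The shortest one-parameter curves between points of a ball of radius `R < π / 2` stay in it. -/
theorem rectDist_expCurve_le (hp : Even p) (hp2 : 2 ≤ p) {R : ℝ} (hR : R < Real.pi / 2)
    (u v W : U n) {θ : Fin n → ℝ} (hθ : ∀ j, |θ j| ≤ Real.pi) (h₀ : rectDist p u v ≤ R)
    (h₁ : rectDist p u (v * conjExp W θ) ≤ R) {t : ℝ} (ht : t ∈ Icc (0 : ℝ) 1) :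
    rectDist p u (expCurve v W θ t) ≤ R := by
  refine Icc_subset_of_isClosed_of_midpoint_mem (S := {t | rectDist p u (expCurve v W θ t) ≤ R})
    (isClosed_preimage_closedBall hp hp2 u R (contDiff_expCurve v W θ).continuous) ?_ ?_ ?_ ht
  · rw [mem_ofPred_eq, (joins_expCurve v W θ).source]; exact h₀
  · rw [mem_ofPred_eq, (joins_expCurve v W θ).target]; exact h₁
  · rintro x ⟨hx, hx'⟩ y ⟨hy, hy'⟩
    refine rectDist_midpoint_le hp hp2 hR u _ W (y := ((y - x) / 2) • θ) (fun j => ?_) ?_ ?_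
    · have h2 : |(y - x) / 2| ≤ 1 / 2 := by
        rw [abs_le]; constructor <;> linarith [hx'.1, hx'.2, hy'.1, hy'.2]
      have h3 : |((y - x) / 2) * θ j| ≤ Real.pi / 2 := by
        rw [abs_mul]
        nlinarith [hθ j, abs_nonneg (θ j), abs_nonneg ((y - x) / 2)]
      rw [abs_le] at h3
      exact Real.cos_nonneg_of_mem_Icc h3
    · rw [expCurve, mul_assoc, ← conjExp_add, ← neg_smul, ← add_smul]
      rw [show (x + y) / 2 + -((y - x) / 2) = x by ring]
      exact hx
    · rw [expCurve, mul_assoc, ← conjExp_add, ← add_smul]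
      rw [show (x + y) / 2 + (y - x) / 2 = y by ring]
      exact hy

theorem exists_isGeodesic_forall_mem (hp : Even p) (hp2 : 2 ≤ p) {R : ℝ} (hR : R < Real.pi / 2)
    {u v w : U n} (hv : rectDist p u v ≤ R) (hw : rectDist p u w ≤ R) :
    ∃ γ : ℝ → U n, IsGeodesic p γ v w ∧ ∀ t ∈ Icc (0 : ℝ) 1, rectDist p u (γ t) ≤ R := by
  obtain ⟨W, θ, hθ, h⟩ := exists_eq_conjExp (star v * w)
  have hvw : w = v * conjExp W θ := by rw [← h, ← mul_assoc, Unitary.mul_star_self, one_mul]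
  subst hvw
  exact ⟨expCurve v W θ, isGeodesic_expCurve hp hp2 v W hθ, fun t ht =>
    rectDist_expCurve_le hp hp2 hR u v W hθ hv hw ht⟩

theorem geodesicallyConvex_closedBall (hp : Even p) (hp2 : 2 ≤ p) (u : U n) {r : ℝ}
    (hr : r < Real.pi / 2) : GeodesicallyConvex p (closedBall p u r) :=
  fun _ hv _ hw => exists_isGeodesic_forall_mem hp hp2 hr hv hw

theorem geodesicallyConvex_openBall (hp : Even p) (hp2 : 2 ≤ p) (u : U n) {r : ℝ}
    (hr : r ≤ Real.pi / 2) : GeodesicallyConvex p (openBall p u r) := fun v hv w hw => by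
  have hmax : max (rectDist p u v) (rectDist p u w) < r := max_lt hv hw
  obtain ⟨γ, hγ, h⟩ := exists_isGeodesic_forall_mem hp hp2 (hmax.trans_le hr)
    (le_max_left _ _) (le_max_right _ _)
  exact ⟨γ, hγ, fun t ht => (h t ht).trans_lt hmax⟩

end

/-! ### Failure of convexity in `U_1` -/

section

open Matrix MeasureTheory Set Filter Topology

variable {p : ℕ}

theorem conjExp_apply_zero (W : U 1) (θ : Fin 1 → ℝ) :
    (conjExp W θ : Matrix (Fin 1) (Fin 1) ℂ) 0 0 = Complex.exp (θ 0 * Complex.I) := by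
  have h := sum_row_norm_sq W 0
  rw [coe_conjExp, conjDiag_apply, diag_entry]
  simp only [Fin.sum_univ_one] at h ⊢
  rw [h, Complex.ofReal_one, one_mul]

theorem sum_abs_rpow_fin_one (hp2 : 2 ≤ p) (θ : Fin 1 → ℝ) :
    (∑ j, |θ j| ^ p) ^ (1 / (p : ℝ)) = |θ 0| := by
  rw [Fin.sum_univ_one, one_div, Real.pow_rpow_inv_natCast (abs_nonneg _) (by omega)]

theorem rectDist_mul_conjExp_fin_one (hp : Even p) (hp2 : 2 ≤ p) (u : U 1) {x : ℝ}
    (hx : |x| ≤ Real.pi) : rectDist p u (u * conjExp 1 fun _ => x) = |x| := by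
  rw [rectDist_mul_conjExp hp hp2 u 1 fun _ => hx, sum_abs_rpow_fin_one hp2]

/-- At distance less than `π` from `u` the principal argument is continuous, and vanishes only
at `u`. -/
theorem arg_entry_of_rectDist_lt_pi (hp : Even p) (hp2 : 2 ≤ p) {u z : U 1}
    (h : rectDist p u z < Real.pi) :
    ((star u * z : U 1) : Matrix (Fin 1) (Fin 1) ℂ) 0 0 ∈ Complex.slitPlane ∧
    (Complex.arg (((star u * z : U 1) : Matrix (Fin 1) (Fin 1) ℂ) 0 0) = 0 → z = u) := by
  obtain ⟨W, θ, hθ, e⟩ := exists_eq_conjExp (star u * z)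
  have hz : z = u * conjExp W θ := by rw [← e, ← mul_assoc, Unitary.mul_star_self, one_mul]
  rw [hz, rectDist_mul_conjExp hp hp2 u W hθ, sum_abs_rpow_fin_one hp2, abs_lt] at h
  have harg : Complex.arg (Complex.exp (θ 0 * Complex.I)) = θ 0 := by
    rw [← Circle.coe_exp, Circle.arg_exp h.1 h.2.le]
  rw [e, conjExp_apply_zero, Complex.mem_slitPlane_iff_arg, harg]
  refine ⟨⟨h.2.ne, Complex.exp_ne_zero _⟩, fun h0 => ?_⟩
  have : θ = 0 := funext fun j => by rw [Subsingleton.elim j 0, h0, Pi.zero_apply]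
  rw [hz, this, conjExp_zero, mul_one]

/-- A set in `U_1` that misses the antipode of `u` and contains `u exp (± i x)`, `x > π / 2`,
is not convex: a curve in it between these points passes through `u`, whereas the shortest one
passes through the antipode. -/
theorem not_geodesicallyConvex_fin_one (hp : Even p) (hp2 : 2 ≤ p) (u : U 1) {M : Set (U 1)}
    (hM : ∀ z ∈ M, rectDist p u z < Real.pi) {x : ℝ} (hx : Real.pi / 2 < x) (hxpi : x < Real.pi)
    (h₁ : (u * conjExp 1 fun _ => x) ∈ M) (h₂ : (u * conjExp 1 fun _ => -x) ∈ M) :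
    ¬ GeodesicallyConvex p M := by
  intro hconv
  obtain ⟨γ, ⟨hγ, hmin⟩, hγM⟩ := hconv _ h₁ _ h₂
  have hpi := Real.pi_pos
  have hx0 : |x| = x := abs_of_pos (by linarith)
  set g : ℝ → ℂ := fun t => ((star u * γ t : U 1) : Matrix (Fin 1) (Fin 1) ℂ) 0 0 with hg
  have hgc : ContinuousOn g (Icc 0 1) := by
    have h : ContinuousOn (fun t => ((star u : U 1) : Matrix (Fin 1) (Fin 1) ℂ) *
        toMatrixCurve γ t) (Icc 0 1) := continuousOn_const.mul hγ.piecewiseSmooth.1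
    exact (continuous_apply_apply (0 : Fin 1) (0 : Fin 1)).comp_continuousOn h
  have hprop := fun t ht => arg_entry_of_rectDist_lt_pi hp hp2 (hM _ (hγM t ht))
  have hac : ContinuousOn (fun t => Complex.arg (g t)) (Icc 0 1) := fun t ht =>
    ContinuousAt.comp_continuousWithinAt (f := g) (Complex.continuousAt_arg (hprop t ht).1)
      (hgc t ht)
  have harg : ∀ {t y}, γ t = (u * conjExp 1 fun _ => y) → |y| < Real.pi →
      Complex.arg (g t) = y := fun {t y} h hy => by
    rw [abs_lt] at hy
    simp only [hg]
    rw [h, ← mul_assoc, Unitary.star_mul_self, one_mul, conjExp_apply_zero, ← Circle.coe_exp,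
      Circle.arg_exp hy.1 hy.2.le]
  obtain ⟨t, ht, ht0⟩ := intermediate_value_Icc' zero_le_one hac
    (show (0 : ℝ) ∈ _ by
      rw [harg hγ.source (by rwa [hx0]), harg hγ.target (by rwa [abs_neg, hx0])]
      constructor <;> linarith)
  have htu : γ t = u := (hprop t ht).2 ht0
  have hl₁ := sum_abs_rpow_le_integral (W := 1) (θ := fun _ => -x) hp hp2 hγ.piecewiseSmooth le_rfl
    ht.1 ht.2 (fun _ => by rw [abs_neg, hx0]; exact hxpi.le) (by
      rw [hγ.source, htu, mul_assoc, ← conjExp_add]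
      have : ((fun _ => x) + fun _ => -x : Fin 1 → ℝ) = 0 := funext fun _ => add_neg_cancel x
      rw [this, conjExp_zero, mul_one])
  have hl₂ := sum_abs_rpow_le_integral (W := 1) (θ := fun _ => -x) hp hp2 hγ.piecewiseSmooth ht.1
    ht.2 le_rfl (fun _ => by rw [abs_neg, hx0]; exact hxpi.le) (by rw [hγ.target, htu])
  rw [sum_abs_rpow_fin_one hp2, abs_neg, hx0] at hl₁ hl₂
  have hint := hγ.piecewiseSmooth.intervalIntegrable hp2
  have hadd := intervalIntegral.integral_add_adjacent_intervals
    (hint.mono_set (by rw [uIcc_of_le ht.1, uIcc_of_le zero_le_one];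
                       exact Icc_subset_Icc_right ht.2))
    (hint.mono_set (by rw [uIcc_of_le ht.2, uIcc_of_le zero_le_one];
                       exact Icc_subset_Icc_left ht.1))
  -- The short way round has length `2 π - 2 x`.
  have hshort : (u * conjExp 1 fun _ => -x : U 1)
      = (u * conjExp 1 fun _ => x) * conjExp 1 fun _ => 2 * Real.pi - 2 * x := by
    rw [mul_assoc, ← conjExp_add]
    congr 1
    apply Subtype.ext
    rw [coe_conjExp, coe_conjExp]
    refine congrArg _ (funext fun _ => ?_)
    rw [← Complex.exp_periodic]
    congr 1
    simp only [Pi.add_apply]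
    push_cast
    ring
  have habs : |2 * Real.pi - 2 * x| = 2 * Real.pi - 2 * x := abs_of_nonneg (by linarith)
  rw [hshort, rectDist_mul_conjExp_fin_one hp hp2 _ (by rw [habs]; linarith), habs,
    curveLength] at hmin
  linarith

theorem not_geodesicallyConvex_openBall_fin_one (hp : Even p) (hp2 : 2 ≤ p) (u : U 1) {r : ℝ}
    (hr : Real.pi / 2 < r) (hrpi : r ≤ Real.pi) : ¬ GeodesicallyConvex p (openBall p u r) := by
  obtain ⟨x, hx, hxr⟩ := exists_between hr
  have hxpi := hxr.trans_le hrpi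
  have hx0 : |x| = x := abs_of_pos (by linarith [Real.pi_pos])
  have hd : ∀ y : ℝ, |y| = x → rectDist p u (u * conjExp 1 fun _ => y) < r := fun y hy => by
    rwa [rectDist_mul_conjExp_fin_one hp hp2 u (by rw [hy]; exact hxpi.le), hy]
  exact not_geodesicallyConvex_fin_one hp hp2 u (fun z hz => lt_of_lt_of_le hz hrpi) hx hxpi
    (hd x hx0) (hd (-x) (by rw [abs_neg, hx0]))

theorem not_geodesicallyConvex_closedBall_fin_one (hp : Even p) (hp2 : 2 ≤ p) (u : U 1) {r : ℝ}
    (hr : Real.pi / 2 < r) (hrpi : r < Real.pi) : ¬ GeodesicallyConvex p (closedBall p u r) := by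
  have hr0 : |r| = r := abs_of_pos (by linarith [Real.pi_pos])
  have hd : ∀ y : ℝ, |y| = r → rectDist p u (u * conjExp 1 fun _ => y) ≤ r := fun y hy => by
    rw [rectDist_mul_conjExp_fin_one hp hp2 u (by rw [hy]; exact hrpi.le), hy]
  exact not_geodesicallyConvex_fin_one hp hp2 u (fun z hz => lt_of_le_of_lt hz hrpi) hr hrpi
    (hd r hr0) (hd (-r) (by rw [abs_neg, hr0]))

end

end FinslerUnitary

theorem proposition3p4 (p : ℕ) (hp : Even p) (hp2 : 2 ≤ p) :
    (∀ (n : ℕ) (u : FinslerUnitary.U n) (r : ℝ),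
      (r ≤ Real.pi / 2 →
        FinslerUnitary.GeodesicallyConvex p (FinslerUnitary.openBall p u r)) ∧
      (r < Real.pi / 2 →
        FinslerUnitary.GeodesicallyConvex p (FinslerUnitary.closedBall p u r))) ∧
    (∀ (u : FinslerUnitary.U 1) (r : ℝ), Real.pi / 2 < r →
      (r ≤ Real.pi →
        ¬ FinslerUnitary.GeodesicallyConvex p (FinslerUnitary.openBall p u r)) ∧
      (r < Real.pi →
        ¬ FinslerUnitary.GeodesicallyConvex p (FinslerUnitary.closedBall p u r))) := by
  exact ⟨fun _ u _ => ⟨FinslerUnitary.geodesicallyConvex_openBall hp hp2 u,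
    FinslerUnitary.geodesicallyConvex_closedBall hp hp2 u⟩, fun u _ hr =>
    ⟨FinslerUnitary.not_geodesicallyConvex_openBall_fin_one hp hp2 u hr,
      FinslerUnitary.not_geodesicallyConvex_closedBall_fin_one hp hp2 u hr⟩⟩
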